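/- **Setting.** Let $R$ be a commutative principal ideal domain, $p\in R$ a prime element and $k=R/(p)$. A $p$-module is an $R$-module of finite length annihilated by some power of $p$. The type of a $p$-module $B$ is the partition $\beta$ whose conjugate is given by $\beta'_i=\dim_k p^{i-1}B/p^iB$ ($i\ge 1$). We draw a partition as a diagram whose columns have lengths $\beta_1\ge\beta_2\ge\dots$, so that the $i$-th row has length $\beta'_i$. Let $\mathcal S$ be the category of embeddings $E=(A\subset B)$ of $p$-modules, with commutative squares as morphisms, and let $\mathcal S_2$ be the full subcategory of those with $p^2A=0$. Write $$P_\ell^m=\big((p^{m-\ell})\subset R/(p^m)\big)\quad(\ell\le m),\qquad T_2^{m,r}=\big(((p^{m-2},p^{r-1}))\subset R/(p^m)\oplus R/(p^r)\big)\quad(1\le r\le m-2).$$ The indecomposable objects of $\mathcal S_2$ are, up to isomorphism, the $P_\ell^m$ with $m\ge 1$, $\ell\le\min\{2,m\}$, and the $T_2^{m,r}$ with $1\le r\le m-2$. For an indecomposable $F$, $\mu_F(E)$ denotes the number of summands isomorphic to $F$ in a decomposition of $E$ as a finite direct sum of indecomposables; such a decomposition exists, and the number does not depend on it. **Klein tableaux.**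 An LR-tableau is a weakly increasing sequence of partitions $\gamma^0\le\gamma^1\le\dots\le\gamma^e$ (repetitions of the last partition at the end of the sequence are disregarded) such that $\gamma^\ell_i-\gamma^{\ell-1}_i\le 1$ for all $i$ and all $1\le \ell\le e$, and $\sum_{i\ge j}(\gamma^\ell_i-\gamma^{\ell-1}_i)\le\sum_{i\ge j}(\gamma^{\ell-1}_i-\gamma^{\ell-2}_i)$ for all $j$ and all $2\le\ell\le e$. The boxes of $\gamma^\ell\setminus\gamma^{\ell-1}$ have entry $\ell$; the boxes of $\gamma^0$ are empty. A Klein tableau is an LR-tableau in which each box $b$ with entry $\ell\ge2$ carries a subscript $r=\varphi^\ell(b)\in\mathbb N$ (the symbol of the box is then $\ell_r$) such that: (i) in each row, the subscripts of boxes with the same entry weakly increase from left to right; (ii) the subscript of a box in row $m$ is less than $m$; (iii) a box with entry $\ell$ in row $m$ which lies directly below a box with entry $\ell-1$ has subscript $m-1$; (iv) the total number of symbols $\ell_r$ is at most the number of entries $\ell-1$ in row $r$. For $E=(A\subset B)$ in $\mathcal S$, the tableau $\Pi(E)$ is given by $\gamma^\ell=\mathrm{type}(B/p^\ell A)$, and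 a box $b$ with entry $\ell\ge2$ has subscript $r\ge 1$ if $b\in\gamma^{\ell,r}\setminus\gamma^{\ell,r-1}$, where $$\gamma^{\ell,r}=\mathrm{type}\big(B/(p^\ell A+p(p^{\ell-2}A\cap p^rB))\big).$$ **Proposition.** The map $E\mapsto\Pi(E)$ induces a well-defined bijection from the set of isomorphism classes of objects of $\mathcal S_2$ onto the set of Klein tableaux with entries at most $2$. If $E\in\mathcal S_2$ has Klein tableau $\Pi=\Pi(E)$, then the multiplicities of the indecomposable objects in $E$ are - $\mu_{T_2^{m,r}}(E)=\#\{\text{boxes } 2_r \text{ in row } m\}$ for $1\le r\le m-2$; - $\mu_{P_2^m}(E)=\#\{\text{boxes } 2_{m-1}\text{ in row } m\}$ for $m\ge2$; - $\mu_{P_1^m}(E)=\#\{\text{boxes } 1\text{ in row } m\}-\#\{\text{boxes } 2_m\text{ in any row}\}$ for $m\ge1$; - $\mu_{P_0^m}(E)=\#\{\text{columns of length } m \text{ all of whose boxes are empty}\}+\#\{\text{empty boxes in row } m\text{ directly above a box } 2_m\}$ for $m\ge1$. -/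

import Mathlib

open scoped Pointwise

universe u

/-! ### Finite length `p`-modules and their types -/

section PModules

variable {R : Type u} [CommRing R]

/-- A `p`-module: an `R`-module of finite length annihilated by some power of `p`. -/
structure IsPModule (p : R) (B : Type u) [AddCommGroup B] [Module R B] : Prop where
  finiteLength : IsFiniteLength R B
  exists_pow : ∃ n : ℕ, ∀ b : B, p ^ n • b = 0

/-- The dimension over `k = R/(p)` of the layer `p^i B / p^(i+1) B`, written as the quotient
of `M = p^i B` by `p M`, which carries its natural `R/(p)`-module structure. -/
noncomputable def layerDim (p : R) (B : Type u) [AddCommGroup B] [Module R B] (i : ℕ) : ℕ :=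
  Module.finrank (R ⧸ Ideal.span {p})
    (↥(p ^ i • (⊤ : Submodule R B)) ⧸
      p • (⊤ : Submodule R ↥(p ^ i • (⊤ : Submodule R B))))

variable {p : R} {B B' : Type u} [AddCommGroup B] [Module R B] [AddCommGroup B'] [Module R B']

theorem IsPModule.of_surjective (h : IsPModule p B) (f : B →ₗ[R] B')
    (hf : Function.Surjective f) : IsPModule p B' := by
  refine ⟨h.finiteLength.of_surjective hf, ?_⟩
  obtain ⟨n, hn⟩ := h.exists_pow
  refine ⟨n, fun b => ?_⟩
  obtain ⟨a, rfl⟩ := hf b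
  rw [← map_smul, hn, map_zero]

theorem IsPModule.quotient (h : IsPModule p B) (N : Submodule R B) : IsPModule p (B ⧸ N) :=
  h.of_surjective N.mkQ N.mkQ_surjective

theorem IsPModule.prod (h : IsPModule p B) (h' : IsPModule p B') : IsPModule p (B × B') := by
  obtain ⟨n, hn⟩ := h.exists_pow
  obtain ⟨n', hn'⟩ := h'.exists_pow
  obtain ⟨_, _⟩ := isFiniteLength_iff_isNoetherian_isArtinian.mp h.finiteLength
  obtain ⟨_, _⟩ := isFiniteLength_iff_isNoetherian_isArtinian.mp h'.finiteLength
  refine ⟨isFiniteLength_iff_isNoetherian_isArtinian.mpr ⟨inferInstance, inferInstance⟩,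
    n + n', fun b => Prod.ext ?_ ?_⟩
  · change p ^ (n + n') • b.1 = 0
    rw [pow_add, mul_comm, mul_smul, hn, smul_zero]
  · change p ^ (n + n') • b.2 = 0
    rw [pow_add, mul_smul, hn', smul_zero]

theorem IsPModule.pi {n : ℕ} {F : Fin n → Type u} [∀ i, AddCommGroup (F i)]
    [∀ i, Module R (F i)] (h : ∀ i, IsPModule p (F i)) : IsPModule p (∀ i, F i) := by
  have hN : ∀ i, IsNoetherian R (F i) := fun i =>
    (isFiniteLength_iff_isNoetherian_isArtinian.mp (h i).finiteLength).1
  have hA : ∀ i, IsArtinian R (F i) := fun i =>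
    (isFiniteLength_iff_isNoetherian_isArtinian.mp (h i).finiteLength).2
  refine ⟨isFiniteLength_iff_isNoetherian_isArtinian.mpr ⟨inferInstance, inferInstance⟩, ?_⟩
  choose e he using fun i => (h i).exists_pow
  refine ⟨∑ i, e i, fun b => funext fun i => ?_⟩
  change p ^ (∑ i, e i) • b i = 0
  rw [← Finset.sum_erase_add _ _ (Finset.mem_univ i), pow_add, mul_smul, he, smul_zero]

/-- The multiplication by `p` maps `p^i B / p^(i+1) B` onto `p^(i+1) B / p^(i+2) B`. -/
theorem exists_layer_surjective (p : R) (B : Type u) [AddCommGroup B] [Module R B] (i : ℕ) :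
    ∃ f : (↥(p ^ i • (⊤ : Submodule R B)) ⧸
        p • (⊤ : Submodule R ↥(p ^ i • (⊤ : Submodule R B)))) →ₗ[R]
      (↥(p ^ (i + 1) • (⊤ : Submodule R B)) ⧸
        p • (⊤ : Submodule R ↥(p ^ (i + 1) • (⊤ : Submodule R B)))),
      Function.Surjective f := by
  have key : ∀ x : ↥(p ^ i • (⊤ : Submodule R B)),
      p • (x : B) ∈ p ^ (i + 1) • (⊤ : Submodule R B) := by
    rintro ⟨x, hx⟩
    rw [pow_succ', mul_smul]
    exact Submodule.smul_mem_pointwise_smul _ _ _ hx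
  let g : ↥(p ^ i • (⊤ : Submodule R B)) →ₗ[R] ↥(p ^ (i + 1) • (⊤ : Submodule R B)) :=
    LinearMap.codRestrict _ (p • (p ^ i • (⊤ : Submodule R B)).subtype) key
  have hg : Function.Surjective g := by
    rintro ⟨y, hy⟩
    rw [pow_succ', mul_smul] at hy
    obtain ⟨x, hx, rfl⟩ := hy
    exact ⟨⟨x, hx⟩, rfl⟩
  refine ⟨Submodule.mapQ _ _ g ?_, ?_⟩
  · rintro _ ⟨x, -, rfl⟩
    exact ⟨g x, trivial, (map_smul g p x).symm⟩
  · intro y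
    obtain ⟨y, rfl⟩ := Submodule.mkQ_surjective _ y
    obtain ⟨x, rfl⟩ := hg y
    exact ⟨Submodule.mkQ _ x, rfl⟩

theorem layer_length_ne_top (h : IsPModule p B) (i : ℕ) :
    Module.length R (↥(p ^ i • (⊤ : Submodule R B)) ⧸
      p • (⊤ : Submodule R ↥(p ^ i • (⊤ : Submodule R B)))) ≠ ⊤ := by
  obtain ⟨_, _⟩ := isFiniteLength_iff_isNoetherian_isArtinian.mp h.finiteLength
  exact Module.length_ne_top

theorem layerDim_eq_length [IsDomain R] [IsPrincipalIdealRing R] [Fact (Prime p)]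
    (h : IsPModule p B) (i : ℕ) :
    (layerDim p B i : ℕ∞) = Module.length R (↥(p ^ i • (⊤ : Submodule R B)) ⧸
      p • (⊤ : Submodule R ↥(p ^ i • (⊤ : Submodule R B)))) := by
  have hm : (Ideal.span {p}).IsMaximal :=
    PrincipalIdealRing.isMaximal_of_irreducible (Fact.out : Prime p).irreducible
  let _ := Ideal.Quotient.field (Ideal.span {p})
  set V := (↥(p ^ i • (⊤ : Submodule R B)) ⧸
      p • (⊤ : Submodule R ↥(p ^ i • (⊤ : Submodule R B)))) with hV
  have e := Module.length_eq_of_surjective (S := R) (R := R ⧸ Ideal.span {p}) (M := V)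
    Ideal.Quotient.mk_surjective
  have hne := layer_length_ne_top h i
  obtain ⟨_, _⟩ := isFiniteLength_iff_isNoetherian_isArtinian.mp
    (Module.length_ne_top_iff.mp hne)
  have : Module.Finite (R ⧸ Ideal.span {p}) V :=
    Module.Finite.of_restrictScalars_finite R _ _
  have e2 := Module.length_eq_finrank (R ⧸ Ideal.span {p}) V
  exact e2.symm.trans e.symm

theorem layerDim_antitone [IsDomain R] [IsPrincipalIdealRing R] [Fact (Prime p)]
    (h : IsPModule p B) : Antitone (layerDim p B) := by
  refine antitone_nat_of_succ_le fun i => ?_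
  obtain ⟨f, hf⟩ := exists_layer_surjective p B i
  have := Module.length_le_of_surjective f hf
  rw [← layerDim_eq_length h, ← layerDim_eq_length h] at this
  exact_mod_cast this

theorem layerDim_eq_zero [IsDomain R] [IsPrincipalIdealRing R] [Fact (Prime p)]
    (h : IsPModule p B) {n i : ℕ} (hn : ∀ b : B, p ^ n • b = 0) (hi : n ≤ i) :
    layerDim p B i = 0 := by
  have : Subsingleton ↥(p ^ i • (⊤ : Submodule R B)) := by
    rw [Submodule.subsingleton_iff_eq_bot, eq_bot_iff]
    rintro _ ⟨x, -, rfl⟩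
    obtain ⟨k, rfl⟩ := Nat.exists_eq_add_of_le hi
    change p ^ (n + k) • x = 0
    rw [pow_add, mul_comm, mul_smul, hn, smul_zero]
  have : Subsingleton (↥(p ^ i • (⊤ : Submodule R B)) ⧸
      p • (⊤ : Submodule R ↥(p ^ i • (⊤ : Submodule R B)))) :=
    (Submodule.mkQ_surjective _).subsingleton
  have e := layerDim_eq_length h i
  rw [Module.length_eq_zero] at e
  exact_mod_cast e

theorem finite_typeCells [IsDomain R] [IsPrincipalIdealRing R] [Fact (Prime p)]
    (h : IsPModule p B) : {c : ℕ × ℕ | c.2 < layerDim p B c.1}.Finite := by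
  obtain ⟨n, hn⟩ := h.exists_pow
  refine ((Set.finite_Iio n).prod (Set.finite_Iio (layerDim p B 0))).subset ?_
  rintro ⟨i, j⟩ hij
  simp only [Set.mem_ofPred_eq] at hij
  refine ⟨?_, lt_of_lt_of_le hij (layerDim_antitone h (Nat.zero_le i))⟩
  by_contra hi
  rw [layerDim_eq_zero h hn (not_lt.mp hi)] at hij
  exact Nat.not_lt_zero _ hij

/-- The type of a `p`-module `B`, as a Young diagram whose *columns* are the parts `β₁ ≥ β₂ ≥ …`
of the partition `β` with `B ≅ ⨁ R/(p^{β_j})`: with rows indexed from `0`, the row of index `i`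
has length `dim_k (p^i B / p^(i+1) B)`. -/
noncomputable def moduleType [IsDomain R] [IsPrincipalIdealRing R] [Fact (Prime p)]
    (h : IsPModule p B) : YoungDiagram where
  cells := (finite_typeCells h).toFinset
  isLowerSet := by
    rintro ⟨i, j⟩ ⟨i', j'⟩ hle hij
    simp only [Set.Finite.coe_toFinset, Set.mem_ofPred_eq] at hij ⊢
    exact lt_of_le_of_lt hle.2 (lt_of_lt_of_le hij (layerDim_antitone h hle.1))

theorem rowLen_moduleType [IsDomain R] [IsPrincipalIdealRing R] [Fact (Prime p)]
    (h : IsPModule p B) (i : ℕ) : (moduleType h).rowLen i = layerDim p B i := by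
  refine eq_of_forall_lt_iff fun j => ?_
  rw [← YoungDiagram.mem_iff_lt_rowLen, ← YoungDiagram.mem_cells]
  simp [moduleType]

end PModules

/-! ### The category of embeddings -/

/-- An object of the category `𝒮`: an embedding `A ⊆ B` of `p`-modules, that is, a `p`-module
together with a submodule. -/
structure PEmb (R : Type u) [CommRing R] (p : R) where
  B : Type u
  [addCommGroup : AddCommGroup B]
  [module : Module R B]
  isPModule : IsPModule p B
  A : Submodule R B

attribute [instance] PEmb.addCommGroup PEmb.module

namespace PEmb

variable {R : Type u} [CommRing R] {p : R}

/-- Isomorphism of embeddings: an isomorphism of the big modules that carries one submodule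
onto the other. -/
def Iso (E F : PEmb R p) : Prop :=
  ∃ f : E.B ≃ₗ[R] F.B, E.A.map (f : E.B →ₗ[R] F.B) = F.A

theorem Iso.refl (E : PEmb R p) : E.Iso E := ⟨LinearEquiv.refl R E.B, by simp⟩

theorem Iso.symm {E F : PEmb R p} (h : E.Iso F) : F.Iso E := by
  obtain ⟨f, hf⟩ := h
  refine ⟨f.symm, ?_⟩
  rw [← hf, ← Submodule.map_comp]
  simp

theorem Iso.trans {E F G : PEmb R p} (h : E.Iso F) (h' : F.Iso G) : E.Iso G := by
  obtain ⟨f, hf⟩ := h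
  obtain ⟨g, hg⟩ := h'
  refine ⟨f.trans g, ?_⟩
  rw [← hg, ← hf, ← Submodule.map_comp]
  simp

/-- The objects of `𝒮₂`: embeddings `A ⊆ B` with `p² A = 0`. -/
def InS2 (E : PEmb R p) : Prop := ∀ a ∈ E.A, p ^ 2 • a = 0

/-- The equivalence relation of isomorphism on the objects of `𝒮₂`. -/
def isoSetoid (R : Type u) [CommRing R] (p : R) : Setoid {E : PEmb R p // E.InS2} where
  r E F := E.1.Iso F.1
  iseqv := ⟨fun E => Iso.refl E.1, Iso.symm, Iso.trans⟩

/-- The direct sum of two embeddings. -/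
def prod (E F : PEmb R p) : PEmb R p where
  B := E.B × F.B
  isPModule := E.isPModule.prod F.isPModule
  A := E.A.prod F.A

/-- The direct sum of a finite family of embeddings. -/
def directSum {n : ℕ} (F : Fin n → PEmb R p) : PEmb R p where
  B := ∀ i, (F i).B
  isPModule := IsPModule.pi fun i => (F i).isPModule
  A := Submodule.pi Set.univ fun i => (F i).A

/-- The zero object: the big module (hence also the submodule) is zero. -/
def IsZero (E : PEmb R p) : Prop := Subsingleton E.B

/-- Indecomposable objects: nonzero, and not a direct sum of two nonzero objects. -/
def Indecomposable (E : PEmb R p) : Prop :=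
  ¬ E.IsZero ∧ ∀ F G : PEmb R p, E.Iso (F.prod G) → F.IsZero ∨ G.IsZero

/-- `F` is the family of summands in a direct sum decomposition of `E` into indecomposables. -/
def IsDecomposition {n : ℕ} (E : PEmb R p) (F : Fin n → PEmb R p) : Prop :=
  (∀ i, (F i).Indecomposable) ∧ E.Iso (directSum F)

/-- `μ_X(E) = k`: the object `E` has a finite direct sum decomposition into indecomposables,
and in every such decomposition exactly `k` of the summands are isomorphic to `X`. -/
def HasMultiplicity (X E : PEmb R p) (k : ℤ) : Prop :=
  (∃ (n : ℕ) (F : Fin n → PEmb R p), E.IsDecomposition F) ∧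
    ∀ (n : ℕ) (F : Fin n → PEmb R p), E.IsDecomposition F →
      (Nat.card {i : Fin n // (F i).Iso X} : ℤ) = k

section Objects

variable [IsDomain R] [IsPrincipalIdealRing R]

theorem isPModule_cyclic (R : Type u) [CommRing R] [IsDomain R] [IsPrincipalIdealRing R]
    (p : R) [Fact (Prime p)] (m : ℕ) : IsPModule p (R ⧸ Ideal.span {p ^ m}) := by
  refine ⟨?_, m, fun b => ?_⟩
  · exact isFiniteLength_quotient_span_singleton R
      (mem_nonZeroDivisors_of_ne_zero (pow_ne_zero m (Fact.out : Prime p).ne_zero))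
  · obtain ⟨b, rfl⟩ := Ideal.Quotient.mk_surjective b
    rw [← Ideal.Quotient.mk_eq_mk, ← Submodule.Quotient.mk_smul, Submodule.Quotient.mk_eq_zero,
      smul_eq_mul]
    exact Ideal.mul_mem_right _ _ (Ideal.mem_span_singleton_self _)

/-- The picket `P_ℓ^m = ((p^(m-ℓ)) ⊆ R/(p^m))`, for `ℓ ≤ m`. -/
def picket (R : Type u) [CommRing R] [IsDomain R] [IsPrincipalIdealRing R] (p : R)
    [Fact (Prime p)] (l m : ℕ) : PEmb R p where
  B := R ⧸ Ideal.span {p ^ m}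
  isPModule := isPModule_cyclic R p m
  A := Submodule.span R {Ideal.Quotient.mk (Ideal.span {p ^ m}) (p ^ (m - l))}

/-- The bipicket `T_2^{m,r} = (((p^(m-2), p^(r-1))) ⊆ R/(p^m) ⊕ R/(p^r))`,
for `1 ≤ r ≤ m - 2`. -/
def bipicket (R : Type u) [CommRing R] [IsDomain R] [IsPrincipalIdealRing R] (p : R)
    [Fact (Prime p)] (m r : ℕ) : PEmb R p where
  B := (R ⧸ Ideal.span {p ^ m}) × (R ⧸ Ideal.span {p ^ r})
  isPModule := (isPModule_cyclic R p m).prod (isPModule_cyclic R p r)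
  A := Submodule.span R {(Ideal.Quotient.mk (Ideal.span {p ^ m}) (p ^ (m - 2)),
    Ideal.Quotient.mk (Ideal.span {p ^ r}) (p ^ (r - 1)))}

end Objects

end PEmb

/-! ### Klein tableaux -/

/-- The data of a labelled tableau: a sequence of partitions `γ^0, γ^1, …`, as Young diagrams
whose columns are the parts, and for each label `ℓ` a subscript function on boxes.
The box in the `m`-th row and `j`-th column (counted from `1`) is the pair `(m - 1, j - 1)`. -/
@[ext]
structure TableauData where
  γ : ℕ → YoungDiagram
  φ : ℕ → ℕ × ℕ → ℕ

namespace TableauData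

/-- The boxes with entry `ℓ ≥ 1`, that is, the skew diagram `γ^ℓ \ γ^(ℓ-1)`. -/
def stripe (T : TableauData) (l : ℕ) : Finset (ℕ × ℕ) := (T.γ l).cells \ (T.γ (l - 1)).cells

/-- The number of boxes with entry `ℓ` in row `m` (rows counted from `1`). -/
def numEntry (T : TableauData) (l m : ℕ) : ℕ := ((T.stripe l).filter fun b => b.1 + 1 = m).card

/-- The number of boxes with symbol `ℓ_r` (in any row). -/
def numSymbol (T : TableauData) (l r : ℕ) : ℕ := ((T.stripe l).filter fun b => T.φ l b = r).card

/-- The number of boxes with symbol `ℓ_r` in row `m` (rows counted from `1`). -/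
def numSymbolInRow (T : TableauData) (l r m : ℕ) : ℕ :=
  ((T.stripe l).filter fun b => T.φ l b = r ∧ b.1 + 1 = m).card

/-- The number of empty columns of length `m` (for `m ≥ 1`): the columns of length `m` in
every `γ^ℓ`, so that none of their boxes carries an entry. -/
noncomputable def numEmptyCol (T : TableauData) (m : ℕ) : ℕ :=
  Set.ncard {j : ℕ | ∀ l, (T.γ l).colLen j = m}

/-- The number of empty boxes in row `m` such that the box immediately below carries the
symbol `ℓ_r`. -/
def numEmptyAbove (T : TableauData) (m l r : ℕ) : ℕ :=
  ((T.γ 0).cells.filter fun b =>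
    b.1 + 1 = m ∧ (b.1 + 1, b.2) ∈ T.stripe l ∧ T.φ l (b.1 + 1, b.2) = r).card

/-- Littlewood-Richardson tableaux: a weakly increasing, eventually constant sequence of
partitions (the tableau does not see repetitions of the last partition) such that each skew
diagram `γ^ℓ \ γ^(ℓ-1)` is a horizontal stripe and the lattice permutation property holds. -/
structure IsLR (T : TableauData) : Prop where
  mono : Monotone T.γ
  eventually_const : ∃ e, ∀ l, e ≤ l → T.γ l = T.γ e
  horizontal : ∀ l, 1 ≤ l → ∀ j, (T.γ l).colLen j ≤ (T.γ (l - 1)).colLen j + 1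
  lattice : ∀ l, 2 ≤ l → ∀ k : ℕ,
    ((T.stripe l).filter fun b => k ≤ b.2).card ≤
      ((T.stripe (l - 1)).filter fun b => k ≤ b.2).card

/-- The map `φ` is an `ℓ`-subscript function on the boxes with entry `ℓ`. -/
structure IsSubscriptFunction (T : TableauData) (l : ℕ) : Prop where
  /-- In each row the subscripts weakly increase. -/
  row_mono : ∀ i j j', (i, j) ∈ T.stripe l → (i, j') ∈ T.stripe l → j ≤ j' →
    T.φ l (i, j) ≤ T.φ l (i, j')
  /-- The subscript of a box in row `m = i + 1` is less than `m`. -/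
  lt_row : ∀ i j, (i, j) ∈ T.stripe l → T.φ l (i, j) < i + 1
  /-- A box in row `m = i + 2` below a box with entry `ℓ - 1` has subscript `m - 1`. -/
  eq_of_above : ∀ i j, (i + 1, j) ∈ T.stripe l → (i, j) ∈ T.stripe (l - 1) →
    T.φ l (i + 1, j) = i + 1
  /-- There are at least as many entries `ℓ - 1` in row `r` as there are symbols `ℓ_r`. -/
  card_le : ∀ r, T.numSymbol l r ≤ T.numEntry (l - 1) r

/-- Klein tableaux: LR-tableaux with subscript functions for all entries `ℓ ≥ 2`. Only boxes
with an entry `ℓ ≥ 2` carry a subscript; elsewhere `φ` takes the dummy value `0`. -/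
structure IsKlein (T : TableauData) : Prop where
  isLR : T.IsLR
  subscript : ∀ l, 2 ≤ l → T.IsSubscriptFunction l
  dummy : ∀ l b, ¬ (2 ≤ l ∧ b ∈ T.stripe l) → T.φ l b = 0

/-- The entries of the tableau are at most `n`. -/
def EntriesAtMost (T : TableauData) (n : ℕ) : Prop := ∀ l, n < l → T.stripe l = ∅

end TableauData

/-! ### The Klein tableau of an embedding -/

namespace PEmb

variable {R : Type u} [CommRing R] [IsDomain R] [IsPrincipalIdealRing R] {p : R} [Fact (Prime p)]

/-- The partition `γ^ℓ = type (B / p^ℓ A)`. -/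
noncomputable def lrPart (E : PEmb R p) (l : ℕ) : YoungDiagram :=
  moduleType (E.isPModule.quotient (p ^ l • E.A))

/-- The partition `γ^{ℓ,r} = type (B / (p^ℓ A + p (p^(ℓ-2) A ∩ p^r B)))`, for `ℓ ≥ 2`. -/
noncomputable def kleinPart (E : PEmb R p) (l r : ℕ) : YoungDiagram :=
  moduleType (E.isPModule.quotient
    (p ^ l • E.A ⊔ p • (p ^ (l - 2) • E.A ⊓ p ^ r • (⊤ : Submodule R E.B))))

/-- The Klein tableau `Π(E)`: its partitions are the `γ^ℓ`, and a box with entry `ℓ ≥ 2` has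
the subscript `r ≥ 1` for which it lies in `γ^{ℓ,r} \ γ^{ℓ,r-1}`
(these skew diagrams partition `γ^ℓ \ γ^(ℓ-1)`); all other values of `φ` are the dummy `0`. -/
noncomputable def klein (E : PEmb R p) : TableauData where
  γ := E.lrPart
  φ l b := sInf {r : ℕ | 2 ≤ l ∧ 1 ≤ r ∧
    b ∈ (E.kleinPart l r).cells \ (E.kleinPart l (r - 1)).cells}

end PEmb

/-! Every partition entering `Π(E)` is additive in `E`. Row lengths are layer dimensions, these are
differences of lengths of the quotients by `p^i`, and the submodules `p^ℓ A` and `p^ℓ A + p (p^(ℓ-2)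
A ∩ p^r B)` are formed componentwise in a direct sum. So if `E` is a sum of objects `std σ`, all row
lengths of `γ^ℓ` and `γ^{2,r}` are sums of rows known for each shape. In these sums `two s d`
contributes one entry 1 in row `s+1` and one symbol `2_(s+1)` in row `s+d+2`, `soc t` contributes
one entry 1 in row `t+1`, and `emb t` contributes only empty boxes. The first two kinds are
therefore counted directly. A summand `emb t` need not appear as an empty column, since the columns
of the sum are sorted by length; its multiplicity comes out of a count of the columns ending in a
given row (`columns_identity`, compared with `Shape.row_identity`). The result is `klein_mult`: the
multiplicity of each shape is read off `Π(E)`.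

Decompositions exist because a nonzero object of `𝒮₂` always splits off some `std σ`
(`exists_iso_std_prod`). The summand is built on an element `x` of maximal order, and the case
depends on how deep the socle element `p^n x` lies in `A`. The retractions come from the
self-injectivity of `R/(q)` for `q ≠ 0` (`baer_quotient_span_singleton`).

The tableau depends only on `E`, so `klein_mult` gives uniqueness of decompositions without any
appeal to local endomorphism rings, and with it the indecomposability of the `std σ`. Finally a
Klein tableau with entries at most 2 is determined by its multiplicities (`IsKlein.ext_mult`), and
these have finite support. Hence equal tableaux force isomorphic objects, and the direct sum with
the multiplicities of a given tableau has that tableau. -/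

/-! ### Layer dimensions through lengths -/

section LayerDim

variable {R : Type u} [CommRing R] {p : R}

theorem pow_smul_top_le {B : Type u} [AddCommGroup B] [Module R B] (p : R) (i : ℕ) :
    p ^ (i + 1) • (⊤ : Submodule R B) ≤ p ^ i • (⊤ : Submodule R B) := by
  rintro _ ⟨x, -, rfl⟩
  exact ⟨p • x, trivial, by simp [pow_succ', mul_smul, smul_comm p]⟩

theorem factor_mk_eq_zero_iff {B : Type u} [AddCommGroup B] [Module R B] {N N' : Submodule R B}
    (h : N ≤ N') (y : B) : Submodule.factor h (Submodule.Quotient.mk y) = 0 ↔ y ∈ N' :=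
  Submodule.Quotient.mk_eq_zero N'

theorem smul_submodule_pi {n : ℕ} {F : Fin n → Type u} [∀ i, AddCommGroup (F i)]
    [∀ i, Module R (F i)] (r : R) (N : ∀ i, Submodule R (F i)) :
    r • Submodule.pi Set.univ N = Submodule.pi Set.univ fun i => r • N i := by
  ext x
  simp only [Submodule.mem_smul_pointwise_iff_exists, Submodule.mem_pi, Set.mem_univ,
    forall_const]
  constructor
  · rintro ⟨y, hy, rfl⟩ i
    exact ⟨y i, hy i, rfl⟩
  · intro hx
    choose y hy using hx
    exact ⟨y, fun i => (hy i).1, funext fun i => (hy i).2⟩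

theorem sup_submodule_pi {n : ℕ} {F : Fin n → Type u} [∀ i, AddCommGroup (F i)]
    [∀ i, Module R (F i)] (N N' : ∀ i, Submodule R (F i)) :
    Submodule.pi Set.univ N ⊔ Submodule.pi Set.univ N' =
      Submodule.pi Set.univ fun i => N i ⊔ N' i := by
  ext x
  simp only [Submodule.mem_sup, Submodule.mem_pi, Set.mem_univ, forall_const]
  constructor
  · rintro ⟨y, hy, z, hz, rfl⟩ i
    exact ⟨y i, hy i, z i, hz i, rfl⟩
  · intro hx
    choose y hy z hz hx using hx
    exact ⟨y, hy, z, hz, funext hx⟩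

theorem inf_submodule_pi {n : ℕ} {F : Fin n → Type u} [∀ i, AddCommGroup (F i)]
    [∀ i, Module R (F i)] (N N' : ∀ i, Submodule R (F i)) :
    Submodule.pi Set.univ N ⊓ Submodule.pi Set.univ N' =
      Submodule.pi Set.univ fun i => N i ⊓ N' i := by
  ext x
  simp [Submodule.mem_pi, forall_and]

theorem submodule_pi_top {n : ℕ} {F : Fin n → Type u} [∀ i, AddCommGroup (F i)]
    [∀ i, Module R (F i)] : Submodule.pi Set.univ (fun i => (⊤ : Submodule R (F i))) = ⊤ := by
  ext x
  simp

/-- The projection `R/(p^m) → R/(p^j)` has kernel generated by `p^j`. -/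
theorem ker_factor_cyclic (p : R) {j m : ℕ} (hjm : j ≤ m) :
    LinearMap.ker (Submodule.factor (p := Ideal.span {p ^ m}) (p' := Ideal.span {p ^ j})
      (Ideal.span_singleton_le_span_singleton.mpr (pow_dvd_pow p hjm))) =
      Submodule.span R {Ideal.Quotient.mk (Ideal.span {p ^ m}) (p ^ j)} := by
  ext y
  obtain ⟨y, rfl⟩ := Submodule.mkQ_surjective _ y
  rw [LinearMap.mem_ker, Submodule.mkQ_apply, factor_mk_eq_zero_iff,
    Ideal.mem_span_singleton, Submodule.mem_span_singleton]
  constructor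
  · rintro ⟨c, rfl⟩
    exact ⟨c, by rw [← Ideal.Quotient.mk_eq_mk, ← Submodule.Quotient.mk_smul, smul_eq_mul, mul_comm]⟩
  · rintro ⟨c, hc⟩
    rw [← Ideal.Quotient.mk_eq_mk, ← Submodule.Quotient.mk_smul, Submodule.Quotient.eq,
      Ideal.mem_span_singleton, smul_eq_mul] at hc
    have := dvd_sub (Dvd.intro_left c rfl) ((pow_dvd_pow p hjm).trans hc)
    simpa using this

variable [IsDomain R] [IsPrincipalIdealRing R] [Fact (Prime p)]

/-- Additivity of length on `0 → p^i B / p^(i+1) B → B / p^(i+1) B → B / p^i B → 0`. -/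
theorem length_quotient_pow_succ {B : Type u} [AddCommGroup B] [Module R B]
    (h : IsPModule p B) (i : ℕ) :
    Module.length R (B ⧸ p ^ (i + 1) • (⊤ : Submodule R B)) =
      layerDim p B i + Module.length R (B ⧸ p ^ i • (⊤ : Submodule R B)) := by
  rw [layerDim_eq_length h]
  refine Module.length_eq_add_of_exact
    (Submodule.mapQ _ (p ^ (i + 1) • (⊤ : Submodule R B)) (p ^ i • (⊤ : Submodule R B)).subtype ?_)
    (Submodule.factor (pow_smul_top_le p i)) ?_ (Submodule.factor_surjective _) ?_
  · rintro _ ⟨⟨_, ⟨x, -, rfl⟩⟩, -, rfl⟩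
    exact ⟨x, trivial, by simp [pow_succ', mul_smul]⟩
  · rw [← LinearMap.ker_eq_bot, LinearMap.ker_eq_bot']
    intro w hw
    obtain ⟨⟨z, hz⟩, rfl⟩ := Submodule.mkQ_surjective _ w
    obtain ⟨y, -, rfl⟩ := id hz
    simp only [Submodule.mkQ_apply, Submodule.mapQ_apply, Submodule.Quotient.mk_eq_zero] at hw ⊢
    obtain ⟨z, -, hz⟩ := hw
    refine ⟨⟨p ^ i • z, ⟨z, trivial, rfl⟩⟩, trivial, Subtype.ext ?_⟩
    simpa [pow_succ', mul_smul] using hz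
  · intro y
    obtain ⟨y, rfl⟩ := Submodule.mkQ_surjective _ y
    rw [Submodule.mkQ_apply, factor_mk_eq_zero_iff]
    constructor
    · intro hy
      exact ⟨Submodule.Quotient.mk ⟨y, hy⟩, rfl⟩
    · rintro ⟨x, hx⟩
      obtain ⟨⟨x, hx'⟩, rfl⟩ := Submodule.mkQ_surjective _ x
      simp only [Submodule.mkQ_apply, Submodule.mapQ_apply] at hx
      rw [Submodule.Quotient.eq] at hx
      have := Submodule.sub_mem _ hx' (pow_smul_top_le p i hx)
      simpa using this

/-- The tool for all computations of types: a layer dimension is a difference of two consecutive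
lengths, so it suffices to know the lengths of the quotients `B / p^i B`. -/
theorem layerDim_eq_of_length {B : Type u} [AddCommGroup B] [Module R B] (h : IsPModule p B)
    {f : ℕ → ℕ} (hf : ∀ i, Module.length R (B ⧸ p ^ i • (⊤ : Submodule R B)) =
      (∑ j ∈ Finset.range i, f j : ℕ)) (i : ℕ) : layerDim p B i = f i := by
  have := length_quotient_pow_succ h i
  rw [hf, hf, Finset.sum_range_succ] at this
  have h2 : (∑ j ∈ Finset.range i, f j) + f i = layerDim p B i + ∑ j ∈ Finset.range i, f j := by
    exact_mod_cast this
  omega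

theorem length_quotient_pow {B : Type u} [AddCommGroup B] [Module R B] (h : IsPModule p B)
    (i : ℕ) : Module.length R (B ⧸ p ^ i • (⊤ : Submodule R B)) =
      (∑ j ∈ Finset.range i, layerDim p B j : ℕ) := by
  induction i with
  | zero =>
    have : Subsingleton (B ⧸ p ^ 0 • (⊤ : Submodule R B)) := by
      rw [pow_zero, one_smul]; infer_instance
    simp [Module.length_eq_zero]
  | succ i ih =>
    rw [length_quotient_pow_succ h, ih, Finset.sum_range_succ]
    push_cast
    ring

theorem layerDim_congr {B B' : Type u} [AddCommGroup B] [Module R B] [AddCommGroup B']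
    [Module R B'] (h : IsPModule p B) (e : B ≃ₗ[R] B') (i : ℕ) :
    layerDim p B' i = layerDim p B i := by
  have h' := h.of_surjective (e : B →ₗ[R] B') e.surjective
  refine layerDim_eq_of_length h' (f := layerDim p B) (fun i => ?_) i
  rw [← length_quotient_pow h]
  refine (Submodule.Quotient.equiv _ _ e ?_).length_eq.symm
  rw [Submodule.map_pointwise_smul, Submodule.map_top, LinearMap.range_eq_top.mpr e.surjective]

theorem layerDim_quotient_of_surjective {B B' : Type u} [AddCommGroup B] [Module R B]
    [AddCommGroup B'] [Module R B'] (h : IsPModule p B) (f : B →ₗ[R] B')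
    (hf : Function.Surjective f) {N : Submodule R B} (hN : LinearMap.ker f = N) (i : ℕ) :
    layerDim p (B ⧸ N) i = layerDim p B' i := by
  subst hN
  exact (layerDim_congr (h.quotient _) (f.quotKerEquivOfSurjective hf) i).symm

theorem layerDim_pi {n : ℕ} {F : Fin n → Type u} [∀ i, AddCommGroup (F i)]
    [∀ i, Module R (F i)] (h : ∀ j, IsPModule p (F j)) (i : ℕ) :
    layerDim p (∀ j, F j) i = ∑ j, layerDim p (F j) i := by
  refine layerDim_eq_of_length (IsPModule.pi h) (f := fun i => ∑ j, layerDim p (F j) i)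
    (fun i => ?_) i
  rw [← submodule_pi_top, smul_submodule_pi, (Submodule.quotientPi _).length_eq,
    Module.length_pi_of_fintype, Finset.sum_comm]
  push_cast
  refine Finset.sum_congr rfl fun j _ => ?_
  rw [length_quotient_pow (h j)]
  push_cast
  rfl

theorem layerDim_quotient_pi {n : ℕ} {F : Fin n → Type u} [∀ i, AddCommGroup (F i)]
    [∀ i, Module R (F i)] (h : ∀ j, IsPModule p (F j)) (N : ∀ j, Submodule R (F j)) (i : ℕ) :
    layerDim p ((∀ j, F j) ⧸ Submodule.pi Set.univ N) i = ∑ j, layerDim p (F j ⧸ N j) i := by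
  rw [← layerDim_pi fun j => (h j).quotient (N j)]
  exact (layerDim_congr ((IsPModule.pi h).quotient _) (Submodule.quotientPi N) i).symm

theorem layerDim_prod {B B' : Type u} [AddCommGroup B] [Module R B] [AddCommGroup B']
    [Module R B'] (h : IsPModule p B) (h' : IsPModule p B') (i : ℕ) :
    layerDim p (B × B') i = layerDim p B i + layerDim p B' i := by
  refine layerDim_eq_of_length (h.prod h') (f := fun i => layerDim p B i + layerDim p B' i)
    (fun i => ?_) i
  have key : (p ^ i • (⊤ : Submodule R (B × B'))) =
      LinearMap.ker ((p ^ i • (⊤ : Submodule R B)).mkQ.prodMap (p ^ i • (⊤ : Submodule R B')).mkQ) := by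
    rw [LinearMap.ker_prodMap, Submodule.ker_mkQ, Submodule.ker_mkQ]
    ext ⟨x, y⟩
    simp [Submodule.mem_smul_pointwise_iff_exists]
  rw [key, (LinearMap.quotKerEquivOfSurjective _ (Prod.map_surjective.mpr
    ⟨Submodule.mkQ_surjective _, Submodule.mkQ_surjective _⟩)).length_eq, Module.length_prod,
    length_quotient_pow h, length_quotient_pow h', Finset.sum_add_distrib]
  push_cast
  rfl

theorem length_cyclic (p : R) [Fact (Prime p)] (m : ℕ) :
    Module.length R (R ⧸ Ideal.span {p ^ m}) = m := by
  have hp : Prime p := Fact.out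
  induction m with
  | zero =>
    have : Subsingleton (R ⧸ Ideal.span {p ^ 0}) := by
      rw [pow_zero, Ideal.span_singleton_one]; exact Ideal.Quotient.subsingleton_iff.mpr rfl
    simp [Module.length_eq_zero]
  | succ m ih =>
    have hmax : (Ideal.span {p}).IsMaximal :=
      PrincipalIdealRing.isMaximal_of_irreducible hp.irreducible
    have hsimple : Module.length R (R ⧸ Ideal.span {p}) = 1 := by
      rw [Module.length_eq_one_iff]
      exact isSimpleModule_iff_isCoatom.mpr (Ideal.isMaximal_def.mp hmax)
    have hle : Ideal.span {p ^ (m + 1)} ≤ Ideal.span {p ^ m} :=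
      Ideal.span_singleton_le_span_singleton.mpr (pow_dvd_pow p m.le_succ)
    rw [Module.length_eq_add_of_exact
      (Submodule.mapQ (Ideal.span {p}) (Ideal.span {p ^ (m + 1)}) (p ^ m • LinearMap.id) ?_)
      (Submodule.factor hle) ?_ (Submodule.factor_surjective _) ?_, hsimple, ih]
    · push_cast; ring
    · intro x hx
      obtain ⟨c, rfl⟩ := Ideal.mem_span_singleton.mp hx
      exact Ideal.mem_span_singleton.mpr ⟨c, by simp [pow_succ]; ring⟩
    · rw [← LinearMap.ker_eq_bot, LinearMap.ker_eq_bot']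
      intro y hy
      obtain ⟨y, rfl⟩ := Submodule.mkQ_surjective _ y
      simp only [Submodule.mkQ_apply, Submodule.mapQ_apply, Submodule.Quotient.mk_eq_zero] at hy ⊢
      obtain ⟨c, hc⟩ := Ideal.mem_span_singleton.mp hy
      refine Ideal.mem_span_singleton.mpr ⟨c, mul_left_cancel₀ (pow_ne_zero m hp.ne_zero) ?_⟩
      simpa [pow_succ, mul_assoc] using hc
    · intro y
      obtain ⟨y, rfl⟩ := Submodule.mkQ_surjective _ y
      rw [Submodule.mkQ_apply, factor_mk_eq_zero_iff]
      constructor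
      · intro hy
        obtain ⟨c, rfl⟩ := Ideal.mem_span_singleton.mp hy
        exact ⟨Submodule.Quotient.mk c, rfl⟩
      · rintro ⟨x, hx⟩
        obtain ⟨x, rfl⟩ := Submodule.mkQ_surjective _ x
        simp only [Submodule.mkQ_apply, Submodule.mapQ_apply] at hx
        rw [Submodule.Quotient.eq] at hx
        have h2 : p ^ m * x ∈ Ideal.span {p ^ m} := Ideal.mul_mem_right _ _
          (Ideal.mem_span_singleton_self _)
        have := Submodule.sub_mem _ h2 (hle hx)
        simpa only [LinearMap.smul_apply, LinearMap.id_apply, smul_eq_mul, sub_sub_cancel] using this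

theorem layerDim_cyclic (p : R) [Fact (Prime p)] (m i : ℕ) :
    layerDim p (R ⧸ Ideal.span {p ^ m}) i = if i < m then 1 else 0 := by
  refine layerDim_eq_of_length (PEmb.isPModule_cyclic R p m)
    (f := fun i => if i < m then 1 else 0) (fun i => ?_) i
  have hsum : (∑ j ∈ Finset.range i, if j < m then 1 else 0) = min i m := by
    rw [Finset.sum_boole, Nat.cast_id, ← Finset.card_range (min i m)]
    congr 1
    ext j
    simp
  have hle : min i m ≤ m := min_le_right _ _
  have key : p ^ i • (⊤ : Submodule R (R ⧸ Ideal.span {p ^ m})) =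
      Submodule.span R {Ideal.Quotient.mk (Ideal.span {p ^ m}) (p ^ min i m)} := by
    ext y
    rw [Submodule.mem_smul_pointwise_iff_exists, Submodule.mem_span_singleton]
    constructor
    · rintro ⟨x, -, rfl⟩
      obtain ⟨x, rfl⟩ := Ideal.Quotient.mk_surjective x
      refine ⟨p ^ (i - min i m) * x, ?_⟩
      rw [← Ideal.Quotient.mk_eq_mk, ← Ideal.Quotient.mk_eq_mk, ← Submodule.Quotient.mk_smul,
        ← Submodule.Quotient.mk_smul, smul_eq_mul, smul_eq_mul, mul_right_comm, ← pow_add,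
        Nat.sub_add_cancel (min_le_left _ _)]
    · rintro ⟨c, rfl⟩
      refine ⟨Ideal.Quotient.mk _ c, trivial, ?_⟩
      rw [← Ideal.Quotient.mk_eq_mk, ← Ideal.Quotient.mk_eq_mk, ← Submodule.Quotient.mk_smul,
        ← Submodule.Quotient.mk_smul, smul_eq_mul, smul_eq_mul, Submodule.Quotient.eq,
        Ideal.mem_span_singleton]
      rcases le_total i m with h | h
      · simp [h, mul_comm]
      · rw [min_eq_right h]
        exact dvd_sub (dvd_mul_of_dvd_left (pow_dvd_pow p h) _) (dvd_mul_left _ _)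
  rw [hsum, key, ← ker_factor_cyclic p hle,
    (LinearMap.quotKerEquivOfSurjective _ (Submodule.factor_surjective _)).length_eq,
    length_cyclic]

end LayerDim

/-! ### The indecomposable objects and their partitions -/

/-- Indices for the indecomposable objects of `𝒮₂`. The index `emb t` stands for the picket
`P_0^(t+1)`, the index `soc t` for `P_1^(t+1)`, and `two s d` for the object with a cyclic
submodule of length two whose generator has height `s` and whose socle has height `s + 1 + d`. -/
inductive Shape : Type
  | emb (t : ℕ)
  | soc (t : ℕ)
  | two (s d : ℕ)
  deriving DecidableEq

namespace Shape

/-- The length of row `i` (counted from `0`) of the partition `γ^l`. -/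
def row : Shape → ℕ → ℕ → ℕ
  | emb t, _, i => if i < t + 1 then 1 else 0
  | soc t, 0, i => if i < t then 1 else 0
  | soc t, _ + 1, i => if i < t + 1 then 1 else 0
  | two s 0, 0, i => if i < s then 1 else 0
  | two s 0, 1, i => if i < s + 1 then 1 else 0
  | two s 0, _ + 2, i => if i < s + 2 then 1 else 0
  | two s (d + 1), 0, i => (if i < s + d + 2 then 1 else 0) + if i < s then 1 else 0
  | two s (d + 1), 1, i => (if i < s + d + 2 then 1 else 0) + if i < s + 1 then 1 else 0
  | two s (d + 1), _ + 2, i => (if i < s + d + 3 then 1 else 0) + if i < s + 1 then 1 else 0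

/-- The length of row `i` (counted from `0`) of the partition `γ^{2,r}`. -/
def subRow : Shape → ℕ → ℕ → ℕ
  | two s d, r, i => if r ≤ s then (two s d).row 1 i else (two s d).row 2 i
  | σ, _, i => σ.row 2 i

theorem row_of_two_le (σ : Shape) {l : ℕ} (hl : 2 ≤ l) (i : ℕ) : σ.row l i = σ.row 2 i := by
  obtain ⟨l, rfl⟩ := Nat.exists_eq_add_of_le' hl
  rcases σ with t | t | ⟨s, _ | d⟩ <;> rfl

end Shape

section Objects

variable {R : Type u} [CommRing R]

theorem smul_span_singleton_eq {B : Type u} [AddCommGroup B] [Module R B] (r : R) (a : B) :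
    r • Submodule.span R {a} = Submodule.span R {r • a} := by
  rw [Submodule.smul_span, Set.smul_set_singleton]

theorem smul_mk (I : Ideal R) (a b : R) :
    a • (Ideal.Quotient.mk I b) = Ideal.Quotient.mk I (a * b) := rfl

theorem mk_pow_eq_zero (p : R) {m j : ℕ} (h : m ≤ j) (c : R) :
    Ideal.Quotient.mk (Ideal.span {p ^ m}) (p ^ j * c) = 0 := by
  rw [Ideal.Quotient.eq_zero_iff_mem, Ideal.mem_span_singleton]
  exact dvd_mul_of_dvd_left (pow_dvd_pow p h) _

/-- The submodule `p^l A + p (p^(l-2) A ∩ p^r B)`. -/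
def kleinSub {B : Type u} [AddCommGroup B] [Module R B] (p : R) (A : Submodule R B) (l r : ℕ) :
    Submodule R B :=
  p ^ l • A ⊔ p • (p ^ (l - 2) • A ⊓ p ^ r • (⊤ : Submodule R B))

theorem smul_pow_eq_bot {B : Type u} [AddCommGroup B] [Module R B] {p : R} {A : Submodule R B}
    {n : ℕ} (h : ∀ a ∈ A, p ^ n • a = 0) {l : ℕ} (hl : n ≤ l) : p ^ l • A = ⊥ := by
  rw [eq_bot_iff]
  rintro _ ⟨a, ha, rfl⟩
  obtain ⟨k, rfl⟩ := Nat.exists_eq_add_of_le' hl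
  change p ^ (k + n) • a = 0
  rw [pow_add, mul_smul, h a ha, smul_zero]

theorem kleinSub_eq_bot {B : Type u} [AddCommGroup B] [Module R B] {p : R} {A : Submodule R B}
    (h : ∀ a ∈ A, p ^ 2 • a = 0) {l r : ℕ} (hl : 2 ≤ l)
    (h' : ∀ x ∈ p ^ (l - 2) • A, x ∈ p ^ r • (⊤ : Submodule R B) → p • x = 0) :
    kleinSub p A l r = ⊥ := by
  rw [kleinSub, smul_pow_eq_bot h hl, bot_sup_eq, eq_bot_iff]
  rintro _ ⟨x, ⟨hx, hx'⟩, rfl⟩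
  exact h' x hx hx'

theorem kleinSub_of_three_le {B : Type u} [AddCommGroup B] [Module R B] {p : R}
    {A : Submodule R B} (h : ∀ a ∈ A, p ^ 2 • a = 0) {l : ℕ} (hl : 3 ≤ l) (r : ℕ) :
    kleinSub p A l r = ⊥ := by
  refine kleinSub_eq_bot h (by omega) fun x hx _ => ?_
  obtain ⟨k, rfl⟩ := Nat.exists_eq_add_of_le' hl
  obtain ⟨a, ha, rfl⟩ := hx
  change p • p ^ (k + 1) • a = 0
  rw [← mul_smul, show p * p ^ (k + 1) = p ^ k * p ^ 2 by ring, mul_smul, h a ha, smul_zero]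

theorem kleinSub_eq_smul {B : Type u} [AddCommGroup B] [Module R B] {p : R} {A : Submodule R B}
    (h : ∀ a ∈ A, p ^ 2 • a = 0) {r : ℕ} (h' : A ≤ p ^ r • (⊤ : Submodule R B)) :
    kleinSub p A 2 r = p • A := by
  rw [kleinSub, smul_pow_eq_bot h le_rfl, bot_sup_eq, Nat.sub_self, pow_zero, one_smul,
    inf_eq_left.mpr h']

theorem smul_eq_zero_of_mem_span {B : Type u} [AddCommGroup B] [Module R B] {r : R} {a : B}
    (h : r • a = 0) (x : B) (hx : x ∈ Submodule.span R {a}) : r • x = 0 := by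
  obtain ⟨c, rfl⟩ := Submodule.mem_span_singleton.mp hx
  rw [smul_comm, h, smul_zero]

/-- The class of `p^j` in `R/(p^m)`. -/
abbrev cycGen (p : R) (m j : ℕ) : R ⧸ Ideal.span {p ^ m} := Ideal.Quotient.mk _ (p ^ j)

theorem cycGen_eq_zero (p : R) {m j : ℕ} (h : m ≤ j) : cycGen p m j = 0 := by
  simpa using mk_pow_eq_zero p h 1

theorem pow_smul_cycGen (p : R) (m j k l : ℕ) (h : k + j = l) :
    p ^ k • cycGen p m j = cycGen p m l := by
  rw [smul_mk, ← pow_add, h]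

theorem smul_cycGen (p : R) (m j l : ℕ) (h : j + 1 = l) : p • cycGen p m j = cycGen p m l := by
  rw [smul_mk, ← pow_succ', h]

theorem span_cycGen_self (p : R) (m : ℕ) : Submodule.span R {cycGen p m m} = ⊥ := by
  rw [cycGen_eq_zero p le_rfl, Submodule.span_zero_singleton]

theorem smul_span_pair (p : R) {m r : ℕ} (h1 : 1 ≤ r) (h2 : r + 2 ≤ m) :
    p • Submodule.span R {(cycGen p m (m - 2), cycGen p r (r - 1))} =
      (Submodule.span R {cycGen p m (m - 1)}).prod ⊥ := by
  have h : p • (cycGen p m (m - 2), cycGen p r (r - 1)) = (cycGen p m (m - 1), 0) := by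
    rw [Prod.smul_mk, smul_cycGen p m _ (m - 1) (by omega), smul_cycGen p r _ r (by omega),
      cycGen_eq_zero p le_rfl]
  rw [smul_span_singleton_eq, h]
  ext ⟨x, y⟩
  simp only [Submodule.mem_prod, Submodule.mem_span_singleton, Submodule.mem_bot, Prod.smul_mk,
    smul_zero, Prod.mk.injEq, exists_and_right, @eq_comm _ y]

theorem sq_smul_pair (p : R) {m r : ℕ} (h1 : 1 ≤ r) (h2 : r + 2 ≤ m) :
    p ^ 2 • (cycGen p m (m - 2), cycGen p r (r - 1)) = 0 := by
  rw [Prod.smul_mk, pow_smul_cycGen p m _ 2 m (by omega), pow_smul_cycGen p r _ 2 (r + 1) (by omega),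
    cycGen_eq_zero p le_rfl, cycGen_eq_zero p (Nat.le_succ r)]
  rfl

variable [IsDomain R] [IsPrincipalIdealRing R] {p : R} [Fact (Prime p)]

theorem layerDim_cyclic_quotient {m j : ℕ} (hj : j ≤ m) (i : ℕ) :
    layerDim p ((R ⧸ Ideal.span {p ^ m}) ⧸ Submodule.span R {cycGen p m j}) i =
      if i < j then 1 else 0 := by
  rw [← layerDim_cyclic p j]
  exact layerDim_quotient_of_surjective (PEmb.isPModule_cyclic R p m) _
    (Submodule.factor_surjective _) (ker_factor_cyclic p hj) i

theorem layerDim_pair_quotient {m r : ℕ} {j : ℕ} (hj : j ≤ m) (i : ℕ) :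
    layerDim p (((R ⧸ Ideal.span {p ^ m}) × (R ⧸ Ideal.span {p ^ r})) ⧸
      (Submodule.span R {cycGen p m j}).prod (⊥ : Submodule R (R ⧸ Ideal.span {p ^ r}))) i =
      (if i < j then 1 else 0) + if i < r then 1 else 0 := by
  rw [← layerDim_cyclic p j, ← layerDim_cyclic p r,
    ← layerDim_prod (PEmb.isPModule_cyclic R p j) (PEmb.isPModule_cyclic R p r)]
  have hle : Ideal.span {p ^ m} ≤ Ideal.span {p ^ j} :=
    Ideal.span_singleton_le_span_singleton.mpr (pow_dvd_pow p hj)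
  refine layerDim_quotient_of_surjective
    ((PEmb.isPModule_cyclic R p m).prod (PEmb.isPModule_cyclic R p r))
    (LinearMap.prodMap (Submodule.factor hle) LinearMap.id)
    (Prod.map_surjective.mpr ⟨Submodule.factor_surjective hle, Function.surjective_id⟩) ?_ i
  rw [LinearMap.ker_prodMap, ker_factor_cyclic p hj, LinearMap.ker_id]

/-- The generator is `p^(r-1)` times `(p^(m-1-r), 1)`, which together with `(1, 0)` generates the
module. In these generators the quotient has type `(m-1, r-1)`; the map `(x, y) ↦ (x - p^(m-1-r) y,
y)` realizes it. -/
theorem layerDim_pair_quotient_diag {m r : ℕ} (h1 : 1 ≤ r) (h2 : r + 2 ≤ m) (i : ℕ) :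
    layerDim p (((R ⧸ Ideal.span {p ^ m}) × (R ⧸ Ideal.span {p ^ r})) ⧸
      Submodule.span R {(cycGen p m (m - 2), cycGen p r (r - 1))}) i =
      (if i < m - 1 then 1 else 0) + if i < r - 1 then 1 else 0 := by
  rw [← layerDim_cyclic p (m - 1), ← layerDim_cyclic p (r - 1),
    ← layerDim_prod (PEmb.isPModule_cyclic R p _) (PEmb.isPModule_cyclic R p _)]
  have hm : Ideal.span {p ^ m} ≤ Ideal.span {p ^ (m - 1)} :=
    Ideal.span_singleton_le_span_singleton.mpr (pow_dvd_pow p (by omega))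
  have hr : Ideal.span {p ^ r} ≤ Ideal.span {p ^ (r - 1)} :=
    Ideal.span_singleton_le_span_singleton.mpr (pow_dvd_pow p (by omega))
  let g : (R ⧸ Ideal.span {p ^ r}) →ₗ[R] (R ⧸ Ideal.span {p ^ (m - 1)}) :=
    Submodule.mapQ _ _ (p ^ (m - 1 - r) • LinearMap.id) (by
      intro x hx
      obtain ⟨c, rfl⟩ := Ideal.mem_span_singleton.mp hx
      refine Ideal.mem_span_singleton.mpr ⟨c, ?_⟩
      rw [LinearMap.smul_apply, LinearMap.id_apply, smul_eq_mul, ← mul_assoc, ← pow_add,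
        Nat.sub_add_cancel (by omega)])
  let f : ((R ⧸ Ideal.span {p ^ m}) × (R ⧸ Ideal.span {p ^ r})) →ₗ[R]
      (R ⧸ Ideal.span {p ^ (m - 1)}) × (R ⧸ Ideal.span {p ^ (r - 1)}) :=
    ((Submodule.factor hm).comp (LinearMap.fst R _ _) - g.comp (LinearMap.snd R _ _)).prod
      ((Submodule.factor hr).comp (LinearMap.snd R _ _))
  have hf : ∀ x y : R, f (Ideal.Quotient.mk _ x, Ideal.Quotient.mk _ y) =
      (Ideal.Quotient.mk _ (x - p ^ (m - 1 - r) * y), Ideal.Quotient.mk _ y) := fun x y => rfl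
  refine layerDim_quotient_of_surjective ((PEmb.isPModule_cyclic R p m).prod (PEmb.isPModule_cyclic R p r)) f ?_ ?_ i
  · rintro ⟨x, y⟩
    obtain ⟨x, rfl⟩ := Ideal.Quotient.mk_surjective x
    obtain ⟨y, rfl⟩ := Ideal.Quotient.mk_surjective y
    refine ⟨(Ideal.Quotient.mk _ (x + p ^ (m - 1 - r) * y), Ideal.Quotient.mk _ y), ?_⟩
    rw [hf, add_sub_cancel_right]
  · refine le_antisymm ?_ ?_
    · rintro ⟨x, y⟩ hxy
      obtain ⟨x, rfl⟩ := Ideal.Quotient.mk_surjective x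
      obtain ⟨y, rfl⟩ := Ideal.Quotient.mk_surjective y
      rw [LinearMap.mem_ker, hf] at hxy
      obtain ⟨hx, hy⟩ := Prod.ext_iff.mp hxy
      obtain ⟨c, rfl⟩ := Ideal.mem_span_singleton.mp (Ideal.Quotient.eq_zero_iff_mem.mp hy)
      obtain ⟨d, hd⟩ := Ideal.mem_span_singleton.mp (Ideal.Quotient.eq_zero_iff_mem.mp hx)
      -- Here `y = p^(r-1) c` and `x - p^(m-1-r) y = p^(m-1) d`, so `x = p^(m-2) (c + p d)`; the
      -- extra `p d` changes the second coordinate by a multiple of `p^r` only.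
      refine Submodule.mem_span_singleton.mpr ⟨c + p * d, Prod.ext ?_ ?_⟩
      · change (c + p * d) • Ideal.Quotient.mk (Ideal.span {p ^ m}) (p ^ (m - 2)) =
          Ideal.Quotient.mk _ x
        rw [smul_mk]
        congr 1
        have e1 : p ^ (m - 1 - r) * p ^ (r - 1) = p ^ (m - 2) := by
          rw [← pow_add]; congr 1; omega
        have e2 : p * p ^ (m - 2) = p ^ (m - 1) := by
          rw [← pow_succ']; congr 1; omega
        linear_combination d * e2 - hd - c * e1
      · change (c + p * d) • Ideal.Quotient.mk (Ideal.span {p ^ r}) (p ^ (r - 1)) =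
          Ideal.Quotient.mk _ (p ^ (r - 1) * c)
        rw [smul_mk, Ideal.Quotient.eq, Ideal.mem_span_singleton]
        have e2 : p * p ^ (r - 1) = p ^ r := by
          rw [← pow_succ']; congr 1; omega
        exact ⟨d, by linear_combination d * e2⟩
    · refine Submodule.span_le.mpr (Set.singleton_subset_iff.mpr ?_)
      rw [SetLike.mem_coe, LinearMap.mem_ker, hf, ← pow_add]
      have e1 : p ^ (m - 1 - r + (r - 1)) = p ^ (m - 2) := by congr 1; omega
      refine Prod.ext ?_ ?_
      · change Ideal.Quotient.mk _ _ = 0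
        rw [e1, sub_self, map_zero]
      · change Ideal.Quotient.mk _ _ = 0
        exact cycGen_eq_zero p le_rfl

/-- The indecomposable object of the given shape. -/
def PEmb.std (R : Type u) [CommRing R] [IsDomain R] [IsPrincipalIdealRing R] (p : R)
    [Fact (Prime p)] : Shape → PEmb R p
  | .emb t => PEmb.picket R p 0 (t + 1)
  | .soc t => PEmb.picket R p 1 (t + 1)
  | .two s 0 => PEmb.picket R p 2 (s + 2)
  | .two s (d + 1) => PEmb.bipicket R p (s + d + 3) (s + 1)

namespace PEmb

theorem std_emb_A (t : ℕ) : (std R p (.emb t)).A = ⊥ := span_cycGen_self p (t + 1)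

theorem std_soc_smul (t : ℕ) (a) (ha : a ∈ (std R p (.soc t)).A) : p • a = 0 :=
  smul_eq_zero_of_mem_span (r := p) (a := cycGen p (t + 1) t)
    ((smul_cycGen p _ t _ rfl).trans (cycGen_eq_zero p le_rfl)) a ha

theorem std_InS2 (σ : Shape) : (std R p σ).InS2 := by
  intro a ha
  rcases σ with t | t | ⟨s, _ | d⟩
  · rw [std_emb_A] at ha
    rw [(Submodule.mem_bot R).mp ha, smul_zero]
  · rw [pow_two, mul_smul, std_soc_smul t a ha, smul_zero]
  · exact smul_eq_zero_of_mem_span (r := p ^ 2) (a := cycGen p (s + 2) s)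
      ((pow_smul_cycGen p _ s 2 (s + 2) (by omega)).trans (cycGen_eq_zero p le_rfl)) a ha
  · exact smul_eq_zero_of_mem_span (r := p ^ 2)
      (sq_smul_pair p (m := s + d + 3) (r := s + 1) (by omega) (by omega)) a ha

theorem layerDim_std (σ : Shape) (l i : ℕ) :
    layerDim p ((std R p σ).B ⧸ p ^ l • (std R p σ).A) i = σ.row l i := by
  rcases σ with t | t | ⟨s, _ | d⟩
  · rw [std_emb_A, Submodule.smul_bot', ← std_emb_A]
    exact layerDim_cyclic_quotient (p := p) (m := t + 1) le_rfl i
  · rcases l with _ | l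
    · rw [pow_zero, one_smul]
      exact layerDim_cyclic_quotient (Nat.le_succ t) i
    · rw [smul_pow_eq_bot (n := 1) (by simpa using std_soc_smul t) (by omega)]
      exact (congrArg (fun N => layerDim p (_ ⧸ N) i) (span_cycGen_self p (t + 1)).symm).trans
        (layerDim_cyclic_quotient (p := p) (m := t + 1) le_rfl i)
  · rcases l with _ | _ | l
    · rw [pow_zero, one_smul]
      exact layerDim_cyclic_quotient (m := s + 2) (j := s) (by omega) i
    · rw [zero_add, pow_one]
      refine Eq.trans (congrArg (fun N : Submodule R (R ⧸ Ideal.span {p ^ (s + 2)}) =>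
        layerDim p (_ ⧸ N) i) ((smul_span_singleton_eq p (cycGen p (s + 2) s)).trans ?_))
        (layerDim_cyclic_quotient (m := s + 2) (j := s + 1) (by omega) i)
      rw [smul_cycGen p _ s _ rfl]
    · rw [smul_pow_eq_bot (std_InS2 _) (by omega)]
      exact (congrArg (fun N => layerDim p (_ ⧸ N) i) (span_cycGen_self p (s + 2)).symm).trans
        (layerDim_cyclic_quotient (p := p) (m := s + 2) le_rfl i)
  · rcases l with _ | _ | l
    · rw [pow_zero, one_smul]
      exact layerDim_pair_quotient_diag (m := s + d + 3) (r := s + 1) (by omega) (by omega) i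
    · rw [zero_add, pow_one]
      exact (congrArg (fun N => layerDim p (_ ⧸ N) i) (smul_span_pair p (m := s + d + 3)
        (r := s + 1) (by omega) (by omega))).trans
        (layerDim_pair_quotient (m := s + d + 3) (r := s + 1) (j := s + d + 2) (by omega) i)
    · rw [smul_pow_eq_bot (std_InS2 _) (by omega)]
      refine Eq.trans (congrArg (fun N : Submodule R ((R ⧸ Ideal.span {p ^ (s + d + 3)}) ×
        (R ⧸ Ideal.span {p ^ (s + 1)})) => layerDim p (_ ⧸ N) i) ?_)
        (layerDim_pair_quotient (p := p) (m := s + d + 3) (r := s + 1) le_rfl i)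
      rw [span_cycGen_self, Submodule.prod_bot]
      rfl

theorem std_two_A_le (s d : ℕ) {r : ℕ} (hr : r ≤ s) :
    (std R p (.two s d)).A ≤ p ^ r • (⊤ : Submodule R (std R p (.two s d)).B) := by
  rcases d with _ | d
  · refine Submodule.span_le.mpr (Set.singleton_subset_iff.mpr ?_)
    refine ⟨Ideal.Quotient.mk (Ideal.span {p ^ (s + 2)}) (p ^ (s - r)), trivial, ?_⟩
    change p ^ r • Ideal.Quotient.mk (Ideal.span {p ^ (s + 2)}) (p ^ (s - r)) = _
    rw [smul_mk, ← pow_add]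
    congr 2
    omega
  · refine Submodule.span_le.mpr (Set.singleton_subset_iff.mpr ?_)
    refine ⟨(Ideal.Quotient.mk (Ideal.span {p ^ (s + d + 3)}) (p ^ (s + d + 1 - r)),
      Ideal.Quotient.mk (Ideal.span {p ^ (s + 1)}) (p ^ (s - r))), trivial, Prod.ext ?_ ?_⟩
    · change p ^ r • Ideal.Quotient.mk (Ideal.span {p ^ (s + d + 3)}) (p ^ (s + d + 1 - r)) = _
      rw [smul_mk, ← pow_add]
      congr 2
      omega
    · change p ^ r • Ideal.Quotient.mk (Ideal.span {p ^ (s + 1)}) (p ^ (s - r)) = _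
      rw [smul_mk, ← pow_add]
      congr 2
      omega

/-- In a bipicket the second coordinate of an element of `p^r B` vanishes for `r > s`, which forces
the coefficient of the generator to be divisible by `p`; then `p • a` is a multiple of `p²` times
the generator. -/
theorem std_two_smul_eq_zero (s d : ℕ) {r : ℕ} (hr : s < r) (a : (std R p (.two s d)).B)
    (ha : a ∈ (std R p (.two s d)).A)
    (ha' : a ∈ p ^ r • (⊤ : Submodule R (std R p (.two s d)).B)) : p • a = 0 := by
  have hp : Prime p := Fact.out
  obtain ⟨b, -, hb⟩ := ha'
  rcases d with _ | d
  · obtain ⟨b, rfl⟩ := Ideal.Quotient.mk_surjective b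
    obtain ⟨k, rfl⟩ := Nat.exists_eq_add_of_lt hr
    rw [← hb]
    change p • p ^ (s + k + 1) • Ideal.Quotient.mk (Ideal.span {p ^ (s + 2)}) b = 0
    rw [← mul_smul, ← pow_succ', smul_mk]
    exact mk_pow_eq_zero p (by omega) b
  · obtain ⟨b1, b2⟩ := b
    obtain ⟨b2, rfl⟩ := Ideal.Quotient.mk_surjective b2
    obtain ⟨c, hc⟩ := (Submodule.mem_span_singleton
      (M := (R ⧸ Ideal.span {p ^ (s + d + 3)}) × (R ⧸ Ideal.span {p ^ (s + 1)}))
      (y := (cycGen p (s + d + 3) (s + d + 1), cycGen p (s + 1) s))).mp ha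
    have h2 : p ^ r • Ideal.Quotient.mk (Ideal.span {p ^ (s + 1)}) b2 = c • cycGen p (s + 1) s :=
      (congrArg Prod.snd hb).trans (congrArg Prod.snd hc).symm
    rw [smul_mk, smul_mk, mk_pow_eq_zero p (by omega), eq_comm, Ideal.Quotient.eq_zero_iff_mem,
      Ideal.mem_span_singleton, mul_comm, pow_succ] at h2
    obtain ⟨e, rfl⟩ := (mul_dvd_mul_iff_left (pow_ne_zero s hp.ne_zero)).mp h2
    rw [← hc]
    change p • (p * e) • (cycGen p (s + d + 3) (s + d + 1), cycGen p (s + 1) s) = 0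
    rw [← mul_smul, ← mul_assoc, ← pow_two, mul_comm, mul_smul]
    exact (congrArg (e • ·) (sq_smul_pair p (m := s + d + 3) (r := s + 1) (by omega)
      (by omega))).trans (smul_zero e)

/-- The generator of `A` in shape `two s d` has height `s`. Up to `r = s` all of `A` lies in `p^r B`
and the submodule is `p A`; beyond that it is zero. So `γ^{2,r}` jumps from `γ^1` to `γ^2` at `r = s
+ 1`, which is the subscript. -/
theorem layerDim_std_kleinSub (σ : Shape) (r i : ℕ) :
    layerDim p ((std R p σ).B ⧸ kleinSub p (std R p σ).A 2 r) i = σ.subRow r i := by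
  have hrow : ∀ l, layerDim p ((std R p σ).B ⧸ p ^ l • (std R p σ).A) i = σ.row l i :=
    fun l => layerDim_std σ l i
  have hbot : (∀ x ∈ (std R p σ).A, x ∈ p ^ r • (⊤ : Submodule R (std R p σ).B) → p • x = 0) →
      layerDim p ((std R p σ).B ⧸ kleinSub p (std R p σ).A 2 r) i = σ.row 2 i := by
    intro h
    rw [kleinSub_eq_bot (std_InS2 σ) le_rfl, ← hrow 2, smul_pow_eq_bot (std_InS2 σ) le_rfl]
    simpa using h
  rcases σ with t | t | ⟨s, d⟩
  · refine hbot fun x hx _ => ?_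
    rw [std_emb_A] at hx
    rw [(Submodule.mem_bot R).mp hx, smul_zero]
  · exact hbot fun x hx _ => std_soc_smul t x hx
  · rw [Shape.subRow]
    split_ifs with h
    · rw [kleinSub_eq_smul (std_InS2 _) (std_two_A_le s d h), ← hrow 1, pow_one]
    · exact hbot fun x hx hx' => std_two_smul_eq_zero s d (not_le.mp h) x hx hx'

end PEmb

end Objects

/-! ### Self-injectivity of `R/(q)` and extension of functionals -/

section Extension

variable {R : Type u} [CommRing R]

theorem exists_lift_cyclic {B : Type u} [AddCommGroup B] [Module R B] {q : R} {x : B}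
    (hx : q • x = 0) : ∃ f : (R ⧸ Ideal.span {q}) →ₗ[R] B,
      ∀ c : R, f (Ideal.Quotient.mk _ c) = c • x := by
  refine ⟨Submodule.liftQ _ (LinearMap.toSpanSingleton R B x) ?_, fun c => rfl⟩
  rw [Ideal.span, Submodule.span_le, Set.singleton_subset_iff]
  simpa using hx

theorem exists_mul_cyclic {a b k : R} (h : b ∣ k * a) :
    ∃ f : (R ⧸ Ideal.span {a}) →ₗ[R] (R ⧸ Ideal.span {b}),
      ∀ c : R, f (Ideal.Quotient.mk _ c) = Ideal.Quotient.mk _ (k * c) := by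
  obtain ⟨f, hf⟩ := exists_lift_cyclic (q := a) (x := Ideal.Quotient.mk (Ideal.span {b}) k) (by
    rw [smul_mk, Ideal.Quotient.eq_zero_iff_mem, Ideal.mem_span_singleton, mul_comm]
    exact h)
  exact ⟨f, fun c => by rw [hf, smul_mk, mul_comm]⟩

/-- If `f x = 0` and `p^(k+1) x = 0`, then `p x` is a kernel element of smaller exponent, hence zero
by induction, so `x` lies in the socle. -/
theorem injective_of_socle {M M' : Type u} [AddCommGroup M] [Module R M] [AddCommGroup M']
    [Module R M'] {p : R} {n : ℕ} (hM : ∀ x : M, p ^ n • x = 0) (f : M →ₗ[R] M')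
    (h : ∀ x, p • x = 0 → f x = 0 → x = 0) : Function.Injective f := by
  rw [← LinearMap.ker_eq_bot, LinearMap.ker_eq_bot']
  have key : ∀ k x, p ^ k • x = 0 → f x = 0 → x = 0 := by
    intro k
    induction k with
    | zero => intro x hx _; simpa using hx
    | succ k ih =>
      intro x hx hfx
      refine h x (ih _ ?_ ?_) hfx
      · rw [← mul_smul, ← pow_succ, hx]
      · rw [map_smul, hfx, smul_zero]
  exact fun x hx => key n x (hM x) hx

theorem exists_eq_smul_cycGen [IsDomain R] {p : R} [Fact (Prime p)] {m k : ℕ} (hk : k ≤ m) (x : R ⧸ Ideal.span {p ^ m})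
    (hx : p ^ k • x = 0) : ∃ c : R, x = c • cycGen p m (m - k) := by
  have hp : Prime p := Fact.out
  obtain ⟨x, rfl⟩ := Ideal.Quotient.mk_surjective x
  have hm : p ^ m = p ^ k * p ^ (m - k) := by rw [← pow_add, Nat.add_sub_cancel' hk]
  rw [smul_mk, Ideal.Quotient.eq_zero_iff_mem, Ideal.mem_span_singleton, hm] at hx
  obtain ⟨c, rfl⟩ := (mul_dvd_mul_iff_left (pow_ne_zero k hp.ne_zero)).mp hx
  exact ⟨c, by rw [smul_mk, mul_comm]⟩

theorem dvd_of_smul_cycGen_eq_zero [IsDomain R] {p : R} [Fact (Prime p)]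
    {m : ℕ} {c : R} (h : c • cycGen p (m + 1) m = 0) : p ∣ c := by
  have hp : Prime p := Fact.out
  rw [smul_mk, Ideal.Quotient.eq_zero_iff_mem, Ideal.mem_span_singleton, pow_succ, mul_comm c] at h
  exact (mul_dvd_mul_iff_left (pow_ne_zero m hp.ne_zero)).mp h

variable [IsDomain R] [IsPrincipalIdealRing R]

/-- An ideal of `R/(q)` is generated by some `d` with `q = c d`. Since `c d = 0` in `R/(q)`, the
image `t` of `d` satisfies `c d ∣ c t`, so `t = d e`, and multiplication by `e` extends the map. -/
theorem baer_quotient_span_singleton {q : R} (hq : q ≠ 0) :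
    Module.Baer (R ⧸ Ideal.span {q}) (R ⧸ Ideal.span {q}) := by
  intro I g
  let J := I.comap (Ideal.Quotient.mk (Ideal.span {q}))
  obtain ⟨d, hd⟩ := (IsPrincipalIdealRing.principal J).principal
  have hdI : Ideal.Quotient.mk _ d ∈ I :=
    show d ∈ J from hd ▸ Submodule.mem_span_singleton_self d
  have hqJ : q ∈ J := by
    change Ideal.Quotient.mk _ q ∈ I
    rw [Ideal.Quotient.eq_zero_iff_mem.mpr (Ideal.mem_span_singleton_self q)]
    exact I.zero_mem
  rw [hd] at hqJ
  obtain ⟨c, hc⟩ := Submodule.mem_span_singleton.mp hqJ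
  obtain ⟨t, ht⟩ := Ideal.Quotient.mk_surjective (g ⟨_, hdI⟩)
  have hct : Ideal.Quotient.mk (Ideal.span {q}) (c * t) = 0 := by
    rw [map_mul, ht, ← smul_eq_mul, ← map_smul]
    have : Ideal.Quotient.mk (Ideal.span {q}) c • (⟨_, hdI⟩ : I) = 0 := by
      refine Subtype.ext ?_
      change Ideal.Quotient.mk _ c * Ideal.Quotient.mk _ d = 0
      rw [← map_mul, Ideal.Quotient.eq_zero_iff_mem, ← hc, smul_eq_mul]
      exact Ideal.mem_span_singleton_self _
    rw [this, map_zero]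
  rw [Ideal.Quotient.eq_zero_iff_mem, Ideal.mem_span_singleton, ← hc, smul_eq_mul] at hct
  have hc0 : c ≠ 0 := by
    rintro rfl
    exact hq (by rw [← hc, zero_smul])
  obtain ⟨e, rfl⟩ := (mul_dvd_mul_iff_left hc0).mp hct
  refine ⟨LinearMap.toSpanSingleton _ _ (Ideal.Quotient.mk _ e), fun x hx => ?_⟩
  obtain ⟨x, rfl⟩ := Ideal.Quotient.mk_surjective x
  have hxJ : x ∈ J := hx
  rw [hd] at hxJ
  obtain ⟨y, rfl⟩ := Submodule.mem_span_singleton.mp hxJ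
  have : (⟨Ideal.Quotient.mk _ (y • d), hx⟩ : I) =
      Ideal.Quotient.mk (Ideal.span {q}) y • (⟨_, hdI⟩ : I) := Subtype.ext (map_mul _ _ _)
  rw [this, g.map_smul, ← ht, LinearMap.toSpanSingleton_apply]
  simp only [smul_eq_mul, ← map_mul, mul_assoc]

theorem exists_extension_of_injective {q : R} (hq : q ≠ 0) {M M' : Type u} [AddCommGroup M]
    [Module R M] [AddCommGroup M'] [Module R M'] (hM : ∀ x : M, q • x = 0)
    (hM' : ∀ x : M', q • x = 0) (i : M' →ₗ[R] M) (hi : Function.Injective i)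
    (g : M' →ₗ[R] R ⧸ Ideal.span {q}) : ∃ h : M →ₗ[R] R ⧸ Ideal.span {q}, ∀ x, h (i x) = g x := by
  have tor : ∀ {N : Type u} [AddCommGroup N] [Module R N], (∀ x : N, q • x = 0) →
      Module.IsTorsionBySet R N (Ideal.span {q} : Ideal R) := by
    intro N _ _ hN
    rw [Module.isTorsionBySet_span_singleton_iff]
    exact hN
  let _ := (tor hM).module
  let _ := (tor hM').module
  have : IsScalarTower R (R ⧸ Ideal.span {q}) M := (tor hM).isScalarTower
  have : IsScalarTower R (R ⧸ Ideal.span {q}) M' := (tor hM').isScalarTower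
  have hs : Function.Surjective (algebraMap R (R ⧸ Ideal.span {q})) :=
    Ideal.Quotient.mk_surjective
  obtain ⟨h, hh⟩ := (baer_quotient_span_singleton hq).extension_property
    (i.extendScalarsOfSurjective hs) hi (g.extendScalarsOfSurjective hs)
  exact ⟨h.restrictScalars R, fun x => LinearMap.congr_fun hh x⟩

/-- A map to `R/(q)` that is zero on `N ∩ q B` factors through the image of `N` in `B / q B`, a
module killed by `q`, where self-injectivity applies. -/
theorem exists_extension {q : R} (hq : q ≠ 0) {B : Type u} [AddCommGroup B] [Module R B]
    (N : Submodule R B) (g : N →ₗ[R] R ⧸ Ideal.span {q})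
    (hg : ∀ x : N, (x : B) ∈ q • (⊤ : Submodule R B) → g x = 0) :
    ∃ f : B →ₗ[R] R ⧸ Ideal.span {q}, ∀ x : N, f x = g x := by
  set φ : N →ₗ[R] B ⧸ q • (⊤ : Submodule R B) := (Submodule.mkQ _).comp N.subtype with hφ
  have hM : ∀ x : B ⧸ q • (⊤ : Submodule R B), q • x = 0 := by
    intro x
    obtain ⟨x, rfl⟩ := Submodule.mkQ_surjective _ x
    rw [← map_smul, Submodule.mkQ_apply, Submodule.Quotient.mk_eq_zero]
    exact ⟨x, trivial, rfl⟩
  have hker : LinearMap.ker φ ≤ LinearMap.ker g := by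
    intro x hx
    exact hg x ((Submodule.Quotient.mk_eq_zero _).mp hx)
  have hinj : Function.Injective ((LinearMap.ker φ).liftQ φ le_rfl) :=
    LinearMap.ker_eq_bot.mp (Submodule.ker_liftQ_eq_bot _ _ _ le_rfl)
  obtain ⟨h, hh⟩ := exists_extension_of_injective hq hM
    (fun x => hinj (by rw [map_smul, hM, map_zero])) _ hinj
    ((LinearMap.ker φ).liftQ g hker)
  exact ⟨h.comp (Submodule.mkQ _), fun x => hh (Submodule.Quotient.mk x)⟩

variable {p : R} [Fact (Prime p)]

/-- Elements outside a submodule are detected by functionals with values in `R/(p^n)`. -/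
theorem exists_functional {n : ℕ} {B : Type u} [AddCommGroup B] [Module R B]
    (hB : ∀ b : B, p ^ (n + 1) • b = 0) (N : Submodule R B) {z : B} (hz : z ∉ N)
    (hpz : p • z ∈ N) :
    ∃ f : B →ₗ[R] R ⧸ Ideal.span {p ^ (n + 1)}, (∀ x ∈ N, f x = 0) ∧ f z = cycGen p (n + 1) n := by
  have hp : Prime p := Fact.out
  -- The class of `z` spans a copy of `R/(p)` in `B / N`. The functional is an extension to `B / N`
  -- of the map sending this class to the socle element `p^n`.
  obtain ⟨i, hi⟩ := exists_lift_cyclic (q := p) (x := N.mkQ z) (by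
    rw [← map_smul, Submodule.mkQ_apply, Submodule.Quotient.mk_eq_zero]; exact hpz)
  obtain ⟨g, hg⟩ := exists_mul_cyclic (a := p) (b := p ^ (n + 1)) (k := p ^ n)
    (by rw [pow_succ])
  have hinj : Function.Injective i := by
    rw [← LinearMap.ker_eq_bot, LinearMap.ker_eq_bot']
    intro c hc
    obtain ⟨c, rfl⟩ := Ideal.Quotient.mk_surjective c
    rw [hi, ← map_smul, Submodule.mkQ_apply, Submodule.Quotient.mk_eq_zero] at hc
    by_contra hne
    rw [Ideal.Quotient.eq_zero_iff_mem, Ideal.mem_span_singleton] at hne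
    obtain ⟨a, b, hab⟩ := hp.irreducible.coprime_iff_not_dvd.mpr hne
    refine hz ?_
    have : z = a • p • z + b • c • z := by
      rw [← mul_smul, ← mul_smul, ← add_smul, hab, one_smul]
    rw [this]
    exact N.add_mem (N.smul_mem _ hpz) (N.smul_mem _ hc)
  obtain ⟨h, hh⟩ := exists_extension_of_injective (pow_ne_zero (n + 1) hp.ne_zero)
    (M := B ⧸ N) (fun x => by
      obtain ⟨x, rfl⟩ := N.mkQ_surjective x
      rw [← map_smul, hB, map_zero])
    (fun x => by
      obtain ⟨x, rfl⟩ := Ideal.Quotient.mk_surjective x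
      rw [smul_mk, Ideal.Quotient.eq_zero_iff_mem, Ideal.mem_span_singleton, pow_succ, mul_right_comm]
      exact dvd_mul_left _ _) i hinj g
  refine ⟨h.comp N.mkQ, fun x hx => ?_, ?_⟩
  · rw [LinearMap.comp_apply, Submodule.mkQ_apply, (Submodule.Quotient.mk_eq_zero N).mpr hx, map_zero]
  · have := hh (Ideal.Quotient.mk _ 1)
    rw [hi, hg, one_smul, mul_one] at this
    exact this

end Extension

/-! ### Splitting off an indecomposable summand -/

namespace PEmb

section Splitting

variable {R : Type u} [CommRing R] {p : R}

/-- An injective endomorphism of an Artinian module is surjective, so `π ∘ ι` is bijective on `C`,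
and by the same argument on `D`. The complement is `ker π` with submodule `A ∩ ker π`. -/
theorem exists_iso_prod (E : PEmb R p) {C : Type u} [AddCommGroup C] [Module R C]
    (hC : IsPModule p C) (D : Submodule R C) (ι : C →ₗ[R] E.B) (π : E.B →ₗ[R] C)
    (hι : ∀ a ∈ D, ι a ∈ E.A) (hπ : ∀ a ∈ E.A, π a ∈ D)
    (hinj : Function.Injective (π.comp ι)) :
    ∃ E' : PEmb R p, E.Iso (PEmb.prod { B := C, isPModule := hC, A := D } E') := by
  obtain ⟨_, _⟩ := isFiniteLength_iff_isNoetherian_isArtinian.mp hC.finiteLength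
  obtain ⟨_, _⟩ := isFiniteLength_iff_isNoetherian_isArtinian.mp E.isPModule.finiteLength
  have hsurj := IsArtinian.surjective_of_injective_endomorphism _ hinj
  have hA : ∀ y ∈ D, ∃ y' ∈ D, π (ι y') = y := by
    let θ : D →ₗ[R] D := (π.comp ι).restrict fun a ha => hπ _ (hι a ha)
    have hθ : Function.Injective θ := fun x y hxy =>
      Subtype.ext (hinj (congrArg Subtype.val hxy))
    intro y hy
    obtain ⟨y', hy'⟩ := IsArtinian.surjective_of_injective_endomorphism θ hθ ⟨y, hy⟩
    exact ⟨y', y'.2, congrArg Subtype.val hy'⟩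
  obtain ⟨n, hn⟩ := E.isPModule.exists_pow
  let E' : PEmb R p :=
    { B := LinearMap.ker π
      isPModule := ⟨isFiniteLength_iff_isNoetherian_isArtinian.mpr ⟨inferInstance, inferInstance⟩,
        n, fun b => Subtype.ext (hn b)⟩
      A := E.A.comap (LinearMap.ker π).subtype }
  let f : C × LinearMap.ker π →ₗ[R] E.B := ι.coprod (LinearMap.ker π).subtype
  have hf : ∀ y (k : LinearMap.ker π), f (y, k) = ι y + k := fun y k => rfl
  have hbij : Function.Bijective f := by
    constructor
    · rw [← LinearMap.ker_eq_bot, LinearMap.ker_eq_bot']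
      rintro ⟨y, k⟩ h
      rw [hf] at h
      have h1 := congrArg π h
      rw [map_add, LinearMap.mem_ker.mp k.2, add_zero, map_zero] at h1
      have h2 : y = 0 := hinj (by rw [map_zero]; exact h1)
      subst h2
      rw [map_zero, zero_add] at h
      exact Prod.ext rfl (Subtype.ext h)
    · intro b
      obtain ⟨y, hy⟩ := hsurj (π b)
      refine ⟨(y, ⟨b - ι y, ?_⟩), ?_⟩
      · rw [LinearMap.mem_ker, map_sub, sub_eq_zero]; exact hy.symm
      · rw [hf]; simp
  refine ⟨E', Iso.symm ⟨LinearEquiv.ofBijective f hbij, le_antisymm ?_ ?_⟩⟩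
  · rintro _ ⟨⟨y, k⟩, ⟨hy, hk⟩, rfl⟩
    exact E.A.add_mem (hι y hy) hk
  · intro a ha
    obtain ⟨y, hy, hya⟩ := hA _ (hπ a ha)
    refine ⟨(y, ⟨a - ι y, ?_⟩), ⟨hy, E.A.sub_mem ha (hι y hy)⟩, ?_⟩
    · rw [LinearMap.mem_ker, map_sub, sub_eq_zero]; exact hya.symm
    · change ι y + (a - ι y) = a
      abel

variable [IsDomain R] [IsPrincipalIdealRing R] [Fact (Prime p)]

/-- A functional `f` that kills `p^l A` but not `p^n x` is a retraction: `f(A)` is annihilated by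
`p^l`, hence lies in `(p^(n+1-l))`, and `f x` is represented by an element prime to `p`. -/
theorem exists_iso_picket_prod (E : PEmb R p) {n l : ℕ} (hl : l ≤ n + 1)
    (hB : ∀ b : E.B, p ^ (n + 1) • b = 0) (x : E.B) (hx : p ^ (n + 1 - l) • x ∈ E.A)
    (hx' : p ^ n • x ∉ p ^ l • E.A) : ∃ E' : PEmb R p, E.Iso ((picket R p l (n + 1)).prod E') := by
  have hp : Prime p := Fact.out
  obtain ⟨f, hf0, hfx⟩ := exists_functional hB (p ^ l • E.A) hx' (by
    rw [← mul_smul, ← pow_succ', hB]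
    exact Submodule.zero_mem _)
  obtain ⟨i, hi⟩ := exists_lift_cyclic (hB x)
  refine exists_iso_prod E (isPModule_cyclic R p (n + 1))
    (Submodule.span R {cycGen p (n + 1) (n + 1 - l)}) i f ?_ ?_ ?_
  · intro a ha
    obtain ⟨c, rfl⟩ := Submodule.mem_span_singleton.mp ha
    rw [map_smul, hi]
    exact E.A.smul_mem _ hx
  · intro a ha
    obtain ⟨c, hc⟩ := exists_eq_smul_cycGen hl (f a) (by
      rw [← map_smul]; exact hf0 _ ⟨a, ha, rfl⟩)
    rw [hc]
    exact Submodule.smul_mem _ c (Submodule.mem_span_singleton_self _)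
  · rw [← LinearMap.ker_eq_bot, LinearMap.ker_eq_bot']
    intro r hr
    obtain ⟨r, rfl⟩ := Ideal.Quotient.mk_surjective r
    rw [LinearMap.comp_apply, hi] at hr
    obtain ⟨c, hc⟩ := Ideal.Quotient.mk_surjective (f x)
    rw [map_smul, ← hc, smul_mk, Ideal.Quotient.eq_zero_iff_mem, Ideal.mem_span_singleton] at hr
    have hpc : ¬ p ∣ c := by
      rintro ⟨e, rfl⟩
      rw [map_smul, ← hc, smul_mk, ← mul_assoc, ← pow_succ, mk_pow_eq_zero p le_rfl, eq_comm,
        ← one_smul R (cycGen _ _ _)] at hfx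
      exact hp.not_isUnit (isUnit_of_dvd_one (dvd_of_smul_cycGen_eq_zero hfx))
    exact Ideal.Quotient.eq_zero_iff_mem.mpr (Ideal.mem_span_singleton.mpr
      (hp.pow_dvd_of_dvd_mul_right _ hpc hr))

/-- The inclusion sends the two basis elements to `x` and to some `y` with `p^s y = a - p^(n+1) x`,
so that the generator goes to `a`. Both coordinates of the retraction extend multiples of one
functional `u : A → R/(p²)`; using the same `u` twice is what keeps the image of `A` inside the
cyclic submodule. -/
theorem exists_iso_bipicket_prod (E : PEmb R p) (hE : E.InS2) {n s : ℕ} (hs : s ≤ n)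
    (hB : ∀ b : E.B, p ^ (n + 3) • b = 0) (a w x : E.B) (ha : a ∈ E.A) (haw : p ^ s • w = a)
    (hax : p • a = p ^ (n + 2) • x)
    (hpa : p • a ∉ p • (E.A ⊓ p ^ (s + 1) • (⊤ : Submodule R E.B))) :
    ∃ E' : PEmb R p, E.Iso ((bipicket R p (n + 3) (s + 1)).prod E') := by
  have hp : Prime p := Fact.out
  obtain ⟨u, hu0, hu1⟩ := exists_functional (p := p) (n := 1) (B := E.A)
    (fun b => Subtype.ext (hE b b.2))
    (p • (p ^ (s + 1) • (⊤ : Submodule R E.B)).comap E.A.subtype) (z := p • ⟨a, ha⟩) (by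
      rintro ⟨b, hb, hba⟩
      exact hpa ⟨b, ⟨b.2, hb⟩, congrArg Subtype.val hba⟩) (by
      rw [← mul_smul, ← pow_two]
      convert Submodule.zero_mem _
      exact Subtype.ext (hE a ha))
  obtain ⟨m1, hm1⟩ := exists_mul_cyclic (R := R) (a := p ^ 2) (b := p ^ (n + 3)) (k := p ^ (n + 1))
    (by rw [← pow_add])
  obtain ⟨m2, hm2⟩ := exists_mul_cyclic (R := R) (a := p ^ 2) (b := p ^ (s + 1)) (k := p ^ s)
    (by rw [← pow_add]; exact pow_dvd_pow p (by omega))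
  obtain ⟨f1, hf1⟩ := exists_extension (pow_ne_zero (n + 3) hp.ne_zero) E.A (m1.comp u) (by
    rintro ⟨b, hb⟩ ⟨y, -, hy⟩
    have : b = 0 := by rw [← hB y]; exact hy.symm
    subst this
    exact map_zero _)
  -- Extendability rests on the choice of `u`: for `b ∈ A ∩ p^(s+1) B` one has `p u(b) = u(p b) =
  -- 0`, so `u(b)` is a multiple of `p` and is killed by `p^s` in `R/(p^(s+1))`.
  obtain ⟨f2, hf2⟩ := exists_extension (pow_ne_zero (s + 1) hp.ne_zero) E.A (m2.comp u) (by
    intro b hb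
    have h0 : p ^ 1 • u b = 0 := by
      rw [pow_one, ← map_smul]
      exact hu0 _ ⟨b, hb, rfl⟩
    obtain ⟨c, hc⟩ := exists_eq_smul_cycGen (by omega) (u b) h0
    rw [LinearMap.comp_apply, hc, map_smul, hm2, ← pow_add]
    exact (congrArg (c • ·) (cycGen_eq_zero p (by omega))).trans (smul_zero c))
  have hgen : ∀ (b : E.B) (hb : b ∈ E.A), ∃ c : R, u ⟨b, hb⟩ = Ideal.Quotient.mk _ c ∧
      f1 b = c • cycGen p (n + 3) (n + 1) ∧ f2 b = c • cycGen p (s + 1) s := by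
    intro b hb
    obtain ⟨c, hc⟩ := Ideal.Quotient.mk_surjective (u ⟨b, hb⟩)
    refine ⟨c, hc.symm, ?_, ?_⟩
    · rw [hf1 ⟨b, hb⟩, LinearMap.comp_apply, ← hc, hm1, smul_mk, mul_comm]
    · rw [hf2 ⟨b, hb⟩, LinearMap.comp_apply, ← hc, hm2, smul_mk, mul_comm]
  obtain ⟨y, hy⟩ : ∃ y, p ^ s • y = a - p ^ (n + 1) • x := by
    refine ⟨w - p ^ (n + 1 - s) • x, ?_⟩
    rw [smul_sub, haw, ← mul_smul, ← pow_add, Nat.add_sub_cancel' (by omega)]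
  have hy0 : p ^ (s + 1) • y = 0 := by
    rw [pow_succ', mul_smul, hy, smul_sub, hax, ← mul_smul, ← pow_succ', sub_self]
  obtain ⟨i1, hi1⟩ := exists_lift_cyclic (hB x)
  obtain ⟨i2, hi2⟩ := exists_lift_cyclic hy0
  refine exists_iso_prod E
    ((isPModule_cyclic R p (n + 3)).prod (isPModule_cyclic R p (s + 1)))
    (Submodule.span R {(cycGen p (n + 3) (n + 1), cycGen p (s + 1) s)}) (i1.coprod i2) (f1.prod f2) ?_ ?_ ?_
  · intro b hb
    obtain ⟨c, rfl⟩ := Submodule.mem_span_singleton.mp hb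
    rw [map_smul, LinearMap.coprod_apply, hi1, hi2, hy, add_sub_cancel]
    exact E.A.smul_mem _ ha
  · intro b hb
    obtain ⟨c, -, h1, h2⟩ := hgen b hb
    exact Submodule.mem_span_singleton.mpr ⟨c, (Prod.ext h1 h2).symm⟩
  · obtain ⟨c, hc, hc1, hc2⟩ := hgen a ha
    rw [map_smul, hc] at hu1
    -- `u(a) = c` and `u(p a) = p` in `R/(p²)`, so `c` is 1 modulo `p`: the retraction fixes the
    -- generator up to multiples of `p`.
    have hpc : p ∣ c - 1 := by
      refine dvd_of_smul_cycGen_eq_zero (m := 1) ?_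
      rw [sub_smul, one_smul, sub_eq_zero]
      refine Eq.trans ?_ hu1
      rw [smul_mk, smul_mk, pow_one, mul_comm]
    obtain ⟨e, he⟩ := hpc
    refine injective_of_socle (p := p) (n := n + 3) (fun v => Prod.ext ?_ ?_) _ ?_
    · obtain ⟨t, ht⟩ := Ideal.Quotient.mk_surjective v.1
      change p ^ (n + 3) • v.1 = 0
      rw [← ht, smul_mk, mk_pow_eq_zero p le_rfl]
    · obtain ⟨t, ht⟩ := Ideal.Quotient.mk_surjective v.2
      change p ^ (n + 3) • v.2 = 0
      rw [← ht, smul_mk, mk_pow_eq_zero p (by omega)]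
    · rintro ⟨v1, v2⟩ hv hfv
      obtain ⟨α, rfl⟩ := exists_eq_smul_cycGen (p := p) (k := 1) (by omega) v1
        (by rw [pow_one]; exact congrArg Prod.fst hv)
      obtain ⟨β, rfl⟩ := exists_eq_smul_cycGen (p := p) (k := 1) (by omega) v2
        (by rw [pow_one]; exact congrArg Prod.snd hv)
      have hι : (i1.coprod i2) (α • cycGen p (n + 3) (n + 3 - 1), β • cycGen p (s + 1) (s + 1 - 1))
          = α • (p • a) + β • (a - p ^ (n + 1) • x) := by
        rw [LinearMap.coprod_apply, map_smul, map_smul, hi1, hi2, hax, ← hy]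
        rfl
      have hv2 : f2 (α • (p • a) + β • (a - p ^ (n + 1) • x)) = 0 := by
        rw [← hι]; exact congrArg Prod.snd hfv
      have hv1 : f1 (α • (p • a) + β • (a - p ^ (n + 1) • x)) = 0 := by
        rw [← hι]; exact congrArg Prod.fst hfv
      have hpg : p • cycGen p (s + 1) s = 0 :=
        (smul_cycGen p _ s _ rfl).trans (cycGen_eq_zero p le_rfl)
      have hf2x : p ^ (n + 1) • f2 x = 0 := by
        obtain ⟨t, ht⟩ := Ideal.Quotient.mk_surjective (f2 x)
        rw [← ht, smul_mk, mk_pow_eq_zero p (by omega)]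
      -- `f2` kills `p a` and `p^(n+1) x` (as `n ≥ s`), so the second coordinate sees only `β`. Once
      -- the `β` term is gone, the first coordinate detects `α`.
      have hβ : p ∣ β := by
        refine dvd_of_smul_cycGen_eq_zero (m := s) ?_
        have hcs : c • cycGen p (s + 1) s = cycGen p (s + 1) s := by
          rw [show c = e * p + 1 by linear_combination he, add_smul, mul_smul, hpg, smul_zero,
            zero_add, one_smul]
        rwa [map_add, map_smul, map_smul, map_smul, map_sub, map_smul, hf2x, sub_zero, hc2, hcs,
          hpg, smul_zero, zero_add] at hv2
      obtain ⟨γ, rfl⟩ := hβ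
      have hz : (p * γ) • (a - p ^ (n + 1) • x) = 0 := by
        rw [← hy, mul_comm, mul_smul, ← mul_smul p, ← pow_succ', hy0, smul_zero]
      rw [hz, add_zero, map_smul, map_smul, hc1, smul_comm p c,
        smul_cycGen p _ (n + 1) (n + 2) rfl, ← mul_smul] at hv1
      have hα := dvd_of_smul_cycGen_eq_zero (m := n + 2) hv1
      have hα' : p ∣ α := by
        have : α = α * c - p * (α * e) := by linear_combination (-α) * he
        rw [this]
        exact dvd_sub hα (dvd_mul_right _ _)
      obtain ⟨δ, rfl⟩ := hα'
      refine Prod.ext ?_ ?_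
      · change (p * δ) • cycGen p (n + 3) (n + 2) = 0
        rw [mul_comm, mul_smul, smul_cycGen p _ (n + 2) _ rfl, cycGen_eq_zero p le_rfl, smul_zero]
      · change (p * γ) • cycGen p (s + 1) s = 0
        rw [mul_comm, mul_smul, hpg, smul_zero]

/-- With `p^(n+1)` the exact exponent of `B`, a picket `P_0` or `P_1` splits off unless `p^n B ⊆ p
A`. In the remaining case each `p^n x` is `p a` for some `a ∈ A`, and the height of `a` decides
between `P_2` and a bipicket. -/
theorem exists_iso_std_prod (E : PEmb R p) (hE : E.InS2) (h0 : ¬ E.IsZero) :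
    ∃ (σ : Shape) (E' : PEmb R p), E.Iso ((std R p σ).prod E') := by
  classical
  have hex := E.isPModule.exists_pow
  have hn := Nat.find_spec hex
  obtain ⟨n, hn1⟩ : ∃ n, Nat.find hex = n + 1 := by
    refine Nat.exists_eq_succ_of_ne_zero fun h => h0 ⟨fun b b' => ?_⟩
    rw [h] at hn
    rw [← one_smul R b, ← one_smul R b', ← pow_zero p, hn, hn]
  rw [hn1] at hn
  obtain ⟨x0, hx0⟩ : ∃ x0 : E.B, p ^ n • x0 ≠ 0 := by
    by_contra! hcon
    have := Nat.find_min' hex hcon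
    omega
  by_cases hA : ∃ x : E.B, p ^ n • x ∉ E.A
  · obtain ⟨x, hx⟩ := hA
    refine ⟨.emb n, exists_iso_picket_prod E (Nat.zero_le _) hn x ?_ (by simpa using hx)⟩
    rw [Nat.sub_zero, hn]
    exact E.A.zero_mem
  by_cases hA1 : ∃ x : E.B, p ^ n • x ∉ p • E.A
  · obtain ⟨x, hx⟩ := hA1
    refine ⟨.soc n, exists_iso_picket_prod E (by omega) hn x ?_ (by simpa using hx)⟩
    by_contra hx'
    exact hA ⟨x, hx'⟩
  push Not at hA hA1
  -- For `n = 0` the module `B` is killed by `p`, so `p A = 0` cannot contain `p^0 x0 ≠ 0`.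
  obtain ⟨n, rfl⟩ : ∃ n', n = n' + 1 := by
    refine Nat.exists_eq_succ_of_ne_zero ?_
    rintro rfl
    obtain ⟨b, -, hb⟩ := hA1 x0
    refine hx0 (hb.symm.trans ?_)
    simpa using hn b
  by_cases hA2 : ∃ x : E.B, p ^ n • x ∈ E.A ∧ p ^ (n + 1) • x ≠ 0
  · obtain ⟨x, hx, hx'⟩ := hA2
    refine ⟨.two n 0, exists_iso_picket_prod E (by omega) hn x hx ?_⟩
    rw [smul_pow_eq_bot hE le_rfl]
    exact hx'
  push Not at hA2
  -- The greatest `s` satisfying `P` is used: maximality says precisely that `p a` is not in `p (A ∩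
  -- p^(s+1) B)`, the condition for splitting off a bipicket. A height of at least `n` would give an
  -- `x` excluded by `hA2`, whence `s < n`.
  let P : ℕ → Prop := fun s => ∃ a ∈ E.A, ∃ w x : E.B, p ^ s • w = a ∧ p • a = p ^ (n + 1) • x ∧
    p • a ≠ 0
  have hP0 : P 0 := by
    obtain ⟨a, ha, hax⟩ := hA1 x0
    exact ⟨a, ha, a, x0, by simp, hax, by rw [show p • a = p ^ (n + 1) • x0 from hax]; exact hx0⟩
  have hPn : ∀ s, P s → s < n := by
    rintro s ⟨a, ha, w, x, hw, hax, ha0⟩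
    by_contra! hns
    refine ha0 ?_
    have h1 : p ^ n • p ^ (s - n) • w = a := by
      rw [← mul_smul, ← pow_add, Nat.add_sub_cancel' hns, hw]
    have := hA2 (p ^ (s - n) • w) (by rwa [h1])
    rwa [pow_succ', mul_smul, h1] at this
  have hPs := Nat.findGreatest_spec (P := P) (Nat.zero_le n) hP0
  set s := Nat.findGreatest P n
  have hPs1 : ¬ P (s + 1) := fun h =>
    Nat.findGreatest_is_greatest (P := P) (Nat.lt_succ_self s) (hPn _ h).le h
  obtain ⟨a, ha, w, x, hw, hax, ha0⟩ := hPs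
  have hsn := hPn s ⟨a, ha, w, x, hw, hax, ha0⟩
  clear_value s
  obtain ⟨d, rfl⟩ := Nat.exists_eq_add_of_lt hsn
  refine ⟨.two s (d + 1), exists_iso_bipicket_prod E hE (n := s + d) (by omega) hn a w x ha hw hax ?_⟩
  rintro ⟨b, ⟨hb, w', -, hw'⟩, hba⟩
  have hba' : p • b = p • a := hba
  exact hPs1 ⟨b, hb, w', x, hw', by rw [hba', hax], by rwa [hba']⟩

end Splitting

end PEmb

/-! ### Young diagrams and Klein tableaux through row lengths -/

theorem YoungDiagram.rowLen_eq_zero (μ : YoungDiagram) {i : ℕ} (h : μ.colLen 0 ≤ i) :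
    μ.rowLen i = 0 := by
  by_contra hne
  have : (i, 0) ∈ μ := YoungDiagram.mem_iff_lt_rowLen.mpr (Nat.pos_of_ne_zero hne)
  exact absurd (YoungDiagram.mem_iff_lt_colLen.mp this) (not_lt.mpr h)

theorem YoungDiagram.ext_rowLen {μ ν : YoungDiagram} (h : ∀ i, μ.rowLen i = ν.rowLen i) :
    μ = ν := by
  refine SetLike.ext ?_
  rintro ⟨i, j⟩
  rw [YoungDiagram.mem_iff_lt_rowLen, YoungDiagram.mem_iff_lt_rowLen, h]

theorem YoungDiagram.rowLen_mono {μ ν : YoungDiagram} (h : μ ≤ ν) (i : ℕ) :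
    μ.rowLen i ≤ ν.rowLen i := by
  by_contra! hlt
  have h1 : (i, ν.rowLen i) ∈ μ := YoungDiagram.mem_iff_lt_rowLen.mpr hlt
  exact lt_irrefl _ (YoungDiagram.mem_iff_lt_rowLen.mp (h h1))

theorem YoungDiagram.le_of_rowLen_le {μ ν : YoungDiagram} (h : ∀ i, μ.rowLen i ≤ ν.rowLen i) :
    μ ≤ ν := by
  rintro ⟨i, j⟩ hij
  exact YoungDiagram.mem_iff_lt_rowLen.mpr
    ((YoungDiagram.mem_iff_lt_rowLen.mp hij).trans_le (h i))

theorem YoungDiagram.colLen_eq_succ_iff {μ : YoungDiagram} {i j : ℕ} :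
    μ.colLen j = i + 1 ↔ μ.rowLen (i + 1) ≤ j ∧ j < μ.rowLen i := by
  rw [← YoungDiagram.mem_iff_lt_rowLen, ← not_lt, ← YoungDiagram.mem_iff_lt_rowLen,
    YoungDiagram.mem_iff_lt_colLen, YoungDiagram.mem_iff_lt_colLen]
  omega

/-- Translates the horizontal stripe condition from columns to rows, the form in which layer
dimensions give access to the partitions. -/
theorem YoungDiagram.colLen_le_succ_iff {μ ν : YoungDiagram} :
    (∀ j, μ.colLen j ≤ ν.colLen j + 1) ↔ ∀ i, μ.rowLen (i + 1) ≤ ν.rowLen i := by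
  constructor
  · intro h i
    by_contra! hlt
    have h1 : (i + 1, ν.rowLen i) ∈ μ := YoungDiagram.mem_iff_lt_rowLen.mpr hlt
    have h2 : (i, ν.rowLen i) ∈ ν := YoungDiagram.mem_iff_lt_colLen.mpr (by
      have := YoungDiagram.mem_iff_lt_colLen.mp h1
      have := h (ν.rowLen i)
      omega)
    exact lt_irrefl _ (YoungDiagram.mem_iff_lt_rowLen.mp h2)
  · intro h j
    by_contra! hlt
    have h1 : (ν.colLen j + 1, j) ∈ μ := YoungDiagram.mem_iff_lt_colLen.mpr hlt
    have h2 : (ν.colLen j, j) ∈ ν := YoungDiagram.mem_iff_lt_rowLen.mpr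
      ((YoungDiagram.mem_iff_lt_rowLen.mp h1).trans_le (h _))
    exact lt_irrefl _ (YoungDiagram.mem_iff_lt_colLen.mp h2)

namespace TableauData

variable {T T' : TableauData}

theorem mem_stripe {l i j : ℕ} :
    (i, j) ∈ T.stripe l ↔ (T.γ (l - 1)).rowLen i ≤ j ∧ j < (T.γ l).rowLen i := by
  rw [stripe, Finset.mem_sdiff, YoungDiagram.mem_cells, YoungDiagram.mem_cells,
    YoungDiagram.mem_iff_lt_rowLen, YoungDiagram.mem_iff_lt_rowLen, not_lt, and_comm]

theorem card_filter_row {S : Finset (ℕ × ℕ)} {P : ℕ × ℕ → Prop} [DecidablePred P] {i : ℕ}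
    {A : Finset ℕ} (h : ∀ b, (b ∈ S ∧ P b) ↔ (b.1 = i ∧ b.2 ∈ A)) : (S.filter P).card = A.card := by
  have : S.filter P = {i} ×ˢ A := by
    ext b
    rw [Finset.mem_filter, h, Finset.mem_product, Finset.mem_singleton]
  rw [this, Finset.card_product, Finset.card_singleton, one_mul]

theorem numEntry_succ (T : TableauData) (l i : ℕ) :
    T.numEntry l (i + 1) = (T.γ l).rowLen i - (T.γ (l - 1)).rowLen i := by
  rw [← Nat.card_Ico]
  refine card_filter_row (i := i) ?_
  rintro ⟨i', j⟩
  rw [mem_stripe, Finset.mem_Ico]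
  constructor
  · rintro ⟨h, h'⟩
    obtain rfl : i' = i := by simpa using h'
    exact ⟨rfl, h⟩
  · rintro ⟨rfl, h⟩
    exact ⟨h, rfl⟩

theorem numEntry_zero (T : TableauData) (l : ℕ) : T.numEntry l 0 = 0 := by
  simp [numEntry]

theorem numSymbolInRow_succ (T : TableauData) (l r i : ℕ) :
    T.numSymbolInRow l r (i + 1) =
      ((Finset.Ico ((T.γ (l - 1)).rowLen i) ((T.γ l).rowLen i)).filter
        fun j => T.φ l (i, j) = r).card := by
  refine card_filter_row (i := i) ?_
  rintro ⟨i', j⟩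
  rw [mem_stripe, Finset.mem_filter, Finset.mem_Ico]
  constructor
  · rintro ⟨h, h', h''⟩
    obtain rfl : i' = i := by simpa using h''
    exact ⟨rfl, h, h'⟩
  · rintro ⟨rfl, h, h'⟩
    exact ⟨h, h', rfl⟩

theorem numSymbol_eq_sum (T : TableauData) (l r : ℕ) {M : ℕ} (hM : (T.γ l).colLen 0 ≤ M) :
    T.numSymbol l r = ∑ i ∈ Finset.range M, T.numSymbolInRow l r (i + 1) := by
  rw [numSymbol, Finset.card_eq_sum_card_fiberwise (f := Prod.fst) (t := Finset.range M)]
  · refine Finset.sum_congr rfl fun i _ => ?_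
    rw [numSymbolInRow, Finset.filter_filter]
    simp
  · rintro ⟨i, j⟩ hb
    rw [Finset.mem_coe, Finset.mem_filter, mem_stripe] at hb
    rw [Finset.mem_coe, Finset.mem_range]
    by_contra! hi
    rw [(T.γ l).rowLen_eq_zero (hM.trans hi)] at hb
    omega

theorem IsLR.rowLen_mono (h : T.IsLR) {l l' : ℕ} (hl : l ≤ l') (i : ℕ) :
    (T.γ l).rowLen i ≤ (T.γ l').rowLen i :=
  YoungDiagram.rowLen_mono (h.mono hl) i

theorem IsLR.rowLen_succ_le (h : T.IsLR) {l : ℕ} (hl : 1 ≤ l) (i : ℕ) :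
    (T.γ l).rowLen (i + 1) ≤ (T.γ (l - 1)).rowLen i :=
  YoungDiagram.colLen_le_succ_iff.mp (h.horizontal l hl) i

theorem γ_eq_of_entriesAtMost (hm : Monotone T.γ) {n l : ℕ} (hT : T.EntriesAtMost n) (hl : n ≤ l) :
    T.γ l = T.γ n := by
  induction l, hl using Nat.le_induction with
  | base => rfl
  | succ l hl ih =>
    rw [← ih]
    refine le_antisymm ?_ (hm l.le_succ)
    have := hT (l + 1) (by omega)
    rw [stripe, Finset.sdiff_eq_empty_iff_subset, Nat.add_sub_cancel] at this
    exact YoungDiagram.cells_subset_iff.mp this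

/-- The lattice permutation property follows from the existence of a subscript function. -/
theorem card_filter_stripe_two_le
    (hh : ∀ l, 1 ≤ l → ∀ i, (T.γ l).rowLen (i + 1) ≤ (T.γ (l - 1)).rowLen i)
    (hs : T.IsSubscriptFunction 2) (k : ℕ) :
    ((T.stripe 2).filter fun b => k ≤ b.2).card ≤ ((T.stripe 1).filter fun b => k ≤ b.2).card := by
  classical
  -- `s` is the first row (from 0) in which column `k` is not an empty box. Above it, every entry 1
  -- lies in a column at least `k`.
  have hex : ∃ s, (T.γ 0).rowLen s ≤ k :=
    ⟨_, by rw [(T.γ 0).rowLen_eq_zero le_rfl]; exact Nat.zero_le _⟩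
  set s := Nat.find hex
  have hsk : (T.γ 0).rowLen s ≤ k := Nat.find_spec hex
  have hlt : ∀ i < s, k < (T.γ 0).rowLen i := fun i hi => not_le.mp (Nat.find_min hex hi)
  clear_value s
  have h11 := hh 1 le_rfl
  have h22 := hh 2 one_le_two
  simp only [Nat.sub_self, Nat.add_one_sub_one] at h11 h22
  set A := (T.stripe 2).filter fun b => T.φ 2 b ≤ s
  set A' := (T.stripe 1).filter fun b => b.1 < s
  -- Condition (iv), summed over the subscripts `r ≤ s`. A subscript counts rows from 1, so these
  -- are the rows of index below `s`.
  have hA : A.card ≤ A'.card := by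
    rw [Finset.card_eq_sum_card_fiberwise (s := A) (f := T.φ 2) (t := Finset.range (s + 1)),
      Finset.card_eq_sum_card_fiberwise (s := A') (f := fun b => b.1 + 1)
        (t := Finset.range (s + 1))]
    · refine Finset.sum_le_sum fun r hr => ?_
      rw [Finset.mem_range] at hr
      have e1 : (A.filter fun b => T.φ 2 b = r).card = T.numSymbol 2 r := by
        rw [numSymbol, Finset.filter_filter]
        congr 1
        refine Finset.filter_congr fun b _ => ?_
        omega
      have e2 : (A'.filter fun b => b.1 + 1 = r).card = T.numEntry 1 r := by
        rw [numEntry, Finset.filter_filter]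
        congr 1
        refine Finset.filter_congr fun b _ => ?_
        omega
      rw [e1, e2]
      exact hs.card_le r
    · intro b hb
      rw [Finset.mem_coe, Finset.mem_range]
      exact Nat.succ_lt_succ (Finset.mem_filter.mp hb).2
    · intro b hb
      rw [Finset.mem_coe, Finset.mem_range]
      exact Nat.lt_succ_of_le (Finset.mem_filter.mp hb).2
  set C := ({s + 1} : Finset ℕ) ×ˢ Finset.Ico k ((T.γ 2).rowLen (s + 1))
  set C' := ({s} : Finset ℕ) ×ˢ Finset.Ico k ((T.γ 1).rowLen s)
  have hC : C.card ≤ C'.card := by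
    simp only [C, C', Finset.card_product, Finset.card_singleton, Nat.card_Ico, one_mul]
    exact Nat.sub_le_sub_right (h22 s) k
  -- In rows of index at most `s` condition (ii) bounds the subscript by `s`. From row `s + 2` on,
  -- two horizontal stripes leave no box in columns `≥ k`, so only row `s + 1` remains.
  have hsub : ((T.stripe 2).filter fun b => k ≤ b.2) ⊆ A ∪ C := by
    rintro ⟨i, j⟩ hb
    obtain ⟨hb, hk⟩ := Finset.mem_filter.mp hb
    have hb' := mem_stripe.mp hb
    simp only at hk
    have his : i ≤ s + 1 := by
      by_contra! hi
      have h1 := (T.γ 2).rowLen_anti (s + 2) i hi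
      have h2 : (T.γ 2).rowLen (s + 2) ≤ _ := h22 (s + 1)
      have h3 := h11 s
      omega
    rw [Finset.mem_union]
    rcases his.lt_or_eq with hi | rfl
    · refine Or.inl (Finset.mem_filter.mpr ⟨hb, ?_⟩)
      have := hs.lt_row i j hb
      omega
    · refine Or.inr (Finset.mem_product.mpr ⟨Finset.mem_singleton_self _, ?_⟩)
      exact Finset.mem_Ico.mpr ⟨hk, hb'.2⟩
  have hdisj : Disjoint A' C' := by
    rw [Finset.disjoint_left]
    intro b hb hb'
    have h1 := (Finset.mem_filter.mp hb).2
    have h2 := Finset.mem_singleton.mp (Finset.mem_product.mp hb').1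
    omega
  have hsub' : A' ∪ C' ⊆ (T.stripe 1).filter fun b => k ≤ b.2 := by
    rintro ⟨i, j⟩ hb
    rw [Finset.mem_filter, mem_stripe]
    rcases Finset.mem_union.mp hb with hb | hb
    · obtain ⟨hb, hi⟩ := Finset.mem_filter.mp hb
      have hb' := mem_stripe.mp hb
      have := hlt i hi
      simp only [Nat.sub_self] at hb' ⊢
      omega
    · obtain ⟨hi, hj⟩ := Finset.mem_product.mp hb
      have hi : i = s := Finset.mem_singleton.mp hi
      have hj := Finset.mem_Ico.mp hj
      subst hi
      simp only [Nat.sub_self] at hj ⊢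
      omega
  calc _ ≤ (A ∪ C).card := Finset.card_le_card hsub
    _ ≤ A.card + C.card := Finset.card_union_le _ _
    _ ≤ A'.card + C'.card := add_le_add hA hC
    _ = (A' ∪ C').card := (Finset.card_union_of_disjoint hdisj).symm
    _ ≤ _ := Finset.card_le_card hsub'

theorem numEmptyCol_succ (h : T.IsLR) (hT : T.EntriesAtMost 2) (i : ℕ) :
    T.numEmptyCol (i + 1) = (T.γ 0).rowLen i - (T.γ 2).rowLen (i + 1) := by
  have : {j : ℕ | ∀ l, (T.γ l).colLen j = i + 1} =
      (Finset.Ico ((T.γ 2).rowLen (i + 1)) ((T.γ 0).rowLen i) : Set ℕ) := by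
    ext j
    simp only [YoungDiagram.colLen_eq_succ_iff, Set.mem_ofPred_eq, Finset.coe_Ico, Set.mem_Ico]
    constructor
    · intro hj
      exact ⟨(hj 2).1, (hj 0).2⟩
    · rintro ⟨h1, h2⟩ l
      refine ⟨?_, h2.trans_le (h.rowLen_mono (Nat.zero_le l) i)⟩
      rcases le_total l 2 with hl | hl
      · exact (h.rowLen_mono hl _).trans h1
      · rwa [γ_eq_of_entriesAtMost h.mono hT hl]
  rw [numEmptyCol, this, Set.ncard_coe_finset, Nat.card_Ico]

theorem numEmptyAbove_succ (T : TableauData) (l i r : ℕ) :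
    T.numEmptyAbove (i + 1) l r =
      ((Finset.Ico ((T.γ (l - 1)).rowLen (i + 1)) ((T.γ l).rowLen (i + 1))).filter
        fun j => T.φ l (i + 1, j) = r ∧ j < (T.γ 0).rowLen i).card := by
  refine card_filter_row (i := i) ?_
  rintro ⟨i', j⟩
  rw [YoungDiagram.mem_cells, YoungDiagram.mem_iff_lt_rowLen, mem_stripe, Finset.mem_filter,
    Finset.mem_Ico]
  simp only
  constructor
  · rintro ⟨h1, h2, h3, h4⟩
    obtain rfl : i' = i := by simpa using h2
    exact ⟨rfl, h3, h4, h1⟩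
  · rintro ⟨rfl, h3, h4, h1⟩
    exact ⟨h1, rfl, h3, h4⟩

/-- Expresses row `i` of `γ^2` by row `i + 1` and data determined by the multiplicities, so that
`γ^2` can be rebuilt from the bottom row upwards. -/
theorem IsKlein.columns_identity (h : T.IsKlein) (hT : T.EntriesAtMost 2) (i : ℕ) :
    T.numEmptyCol (i + 1) + T.numEmptyAbove (i + 1) 2 (i + 1) + T.numEntry 2 (i + 1) +
      T.numEntry 1 (i + 1) + (T.γ 2).rowLen (i + 1) =
      (T.γ 2).rowLen i + T.numSymbolInRow 2 (i + 1) (i + 2) := by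
  have h11 := h.isLR.rowLen_succ_le le_rfl i
  have m01 := h.isLR.rowLen_mono zero_le_one i
  have m12 := h.isLR.rowLen_mono one_le_two i
  have h22 := h.isLR.rowLen_succ_le one_le_two i
  simp only [Nat.sub_self] at h11 h22
  rw [numEmptyCol_succ h.isLR hT, numEmptyAbove_succ, numEntry_succ, numEntry_succ,
    numSymbolInRow_succ]
  set I := Finset.Ico ((T.γ (2 - 1)).rowLen (i + 1)) ((T.γ 2).rowLen (i + 1)) with hI
  -- An entry 2 of row `i + 1` not below an empty box is below an entry 1, and condition (iii) gives
  -- it subscript `i + 1`. The truncated difference thus counts these boxes and compensates the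
  -- truncation in `numEmptyCol_succ`.
  have key : (I.filter fun j => T.φ 2 (i + 1, j) = i + 1).card =
      (I.filter fun j => T.φ 2 (i + 1, j) = i + 1 ∧ j < (T.γ 0).rowLen i).card +
        ((T.γ 2).rowLen (i + 1) - (T.γ 0).rowLen i) := by
    rw [← Nat.card_Ico, ← Finset.card_filter_add_card_filter_not (s := I.filter _)
      (fun j => j < (T.γ 0).rowLen i), Finset.filter_filter, Finset.filter_filter]
    congr 2
    ext j
    simp only [hI, Finset.mem_filter, Finset.mem_Ico, not_lt, Nat.add_one_sub_one]
    constructor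
    · rintro ⟨⟨-, h1⟩, -, h2⟩
      exact ⟨h2, h1⟩
    · rintro ⟨h2, h1⟩
      have hj : (i + 1, j) ∈ T.stripe 2 := mem_stripe.mpr ⟨h11.trans h2, h1⟩
      refine ⟨⟨h11.trans h2, h1⟩, (h.subscript 2 le_rfl).eq_of_above i j hj ?_, h2⟩
      exact mem_stripe.mpr ⟨h2, h1.trans_le h22⟩
  rw [key]
  simp only [Nat.sub_self, Nat.add_one_sub_one]
  omega

/-- The multiplicities that a tableau assigns to the indecomposable objects. -/
noncomputable def mult (T : TableauData) : Shape → ℕ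
  | .emb t => T.numEmptyCol (t + 1) + T.numEmptyAbove (t + 1) 2 (t + 1)
  | .soc t => T.numEntry 1 (t + 1) - T.numSymbol 2 (t + 1)
  | .two s d => T.numSymbolInRow 2 (s + 1) (s + d + 2)

/-- Subscript 0 is excluded by condition (iv), as no row has number 0; the other case is condition
(ii). -/
theorem IsSubscriptFunction.numSymbolInRow_eq_zero (h : T.IsSubscriptFunction 2) {r i : ℕ}
    (hr : r = 0 ∨ i < r) : T.numSymbolInRow 2 r (i + 1) = 0 := by
  rcases hr with rfl | hr
  · have h1 : T.numSymbolInRow 2 0 (i + 1) ≤ T.numSymbol 2 0 :=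
      Finset.card_le_card (Finset.monotone_filter_right _ fun b _ hb => hb.1)
    have h2 := h.card_le 0
    rw [numEntry_zero] at h2
    omega
  · rw [numSymbolInRow, Finset.card_eq_zero, Finset.filter_eq_empty_iff]
    rintro ⟨i', j⟩ hb ⟨h1, h2⟩
    have := h.lt_row i' j hb
    simp only at h2
    omega

theorem numEntry_eq_sum (h : T.IsSubscriptFunction 2) (i : ℕ) :
    T.numEntry 2 (i + 1) = ∑ r ∈ Finset.range (i + 1), T.numSymbolInRow 2 r (i + 1) := by
  rw [numEntry, Finset.card_eq_sum_card_fiberwise (f := T.φ 2) (t := Finset.range (i + 1))]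
  · refine Finset.sum_congr rfl fun r _ => ?_
    rw [numSymbolInRow, Finset.filter_filter]
    congr 1
    exact Finset.filter_congr fun b _ => and_comm
  · rintro ⟨i', j⟩ hb
    obtain ⟨hb, hi⟩ := Finset.mem_filter.mp hb
    have := h.lt_row i' j hb
    rw [Finset.mem_coe, Finset.mem_range]
    simp only at hi
    omega

/-- Subscripts increase weakly along a row, so the boxes with subscript at most `r` form an initial
segment of the stripe, and the number of each symbol per row fixes `φ`. -/
theorem subscript_le_iff (h : T.IsSubscriptFunction 2) {i j : ℕ} (hj : (i, j) ∈ T.stripe 2)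
    (r : ℕ) : T.φ 2 (i, j) ≤ r ↔ j < (T.γ 1).rowLen i +
      ∑ r' ∈ Finset.range (r + 1), T.numSymbolInRow 2 r' (i + 1) := by
  classical
  set I := Finset.Ico ((T.γ 1).rowLen i) ((T.γ 2).rowLen i) with hI
  have hsum : ∑ r' ∈ Finset.range (r + 1), T.numSymbolInRow 2 r' (i + 1) =
      (I.filter fun j => T.φ 2 (i, j) ≤ r).card := by
    rw [Finset.card_eq_sum_card_fiberwise (f := fun j => T.φ 2 (i, j)) (t := Finset.range (r + 1))]
    · refine Finset.sum_congr rfl fun r' hr' => ?_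
      rw [numSymbolInRow_succ, Finset.filter_filter]
      congr 1
      refine Finset.filter_congr fun b _ => ?_
      have := Finset.mem_range.mp hr'
      omega
    · intro j hj
      rw [Finset.mem_coe, Finset.mem_range]
      exact Nat.lt_succ_of_le (Finset.mem_filter.mp hj).2
  rw [hsum]
  have hj' := mem_stripe.mp hj
  simp only [Nat.add_one_sub_one] at hj'
  constructor
  · intro hφ
    have hsub : Finset.Ico ((T.γ 1).rowLen i) (j + 1) ⊆ I.filter fun j => T.φ 2 (i, j) ≤ r := by
      intro j' hj1
      rw [Finset.mem_Ico] at hj1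
      have hmem : (i, j') ∈ T.stripe 2 := mem_stripe.mpr ⟨hj1.1, by omega⟩
      refine Finset.mem_filter.mpr ⟨Finset.mem_Ico.mpr ⟨hj1.1, by omega⟩, ?_⟩
      exact (h.row_mono i j' j hmem hj (by omega)).trans hφ
    have := Finset.card_le_card hsub
    rw [Nat.card_Ico] at this
    omega
  · intro hlt
    by_contra! hφ
    have hsub : (I.filter fun j => T.φ 2 (i, j) ≤ r) ⊆ Finset.Ico ((T.γ 1).rowLen i) j := by
      intro j' hj1
      obtain ⟨hj1, hj2⟩ := Finset.mem_filter.mp hj1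
      rw [hI, Finset.mem_Ico] at hj1
      refine Finset.mem_Ico.mpr ⟨hj1.1, ?_⟩
      by_contra! hle
      have := h.row_mono i j j' hj (mem_stripe.mpr ⟨hj1.1, hj1.2⟩) hle
      omega
    have := Finset.card_le_card hsub
    rw [Nat.card_Ico] at this
    omega

/-- A Klein tableau with entries at most two is determined by its multiplicities. -/
theorem IsKlein.ext_mult (h : T.IsKlein) (hT : T.EntriesAtMost 2) (h' : T'.IsKlein)
    (hT' : T'.EntriesAtMost 2) (hm : T.mult = T'.mult) : T = T' := by
  have hs := h.subscript 2 le_rfl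
  have hs' := h'.subscript 2 le_rfl
  have hrow : ∀ r i, T.numSymbolInRow 2 r (i + 1) = T'.numSymbolInRow 2 r (i + 1) := by
    intro r i
    by_cases hr : r = 0 ∨ i < r
    · rw [hs.numSymbolInRow_eq_zero hr, hs'.numSymbolInRow_eq_zero hr]
    · obtain ⟨s, rfl⟩ := Nat.exists_eq_succ_of_ne_zero (fun h0 => hr (Or.inl h0))
      obtain ⟨d, rfl⟩ := Nat.exists_eq_add_of_le (not_lt.mp fun h0 => hr (Or.inr h0))
      have := congrFun hm (.two s d)
      simp only [mult] at this
      rwa [show s.succ + d + 1 = s + d + 2 by omega]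
  have hsym : ∀ r, T.numSymbol 2 r = T'.numSymbol 2 r := by
    intro r
    rw [T.numSymbol_eq_sum 2 r (le_max_left _ ((T'.γ 2).colLen 0)),
      T'.numSymbol_eq_sum 2 r (le_max_right ((T.γ 2).colLen 0) _)]
    exact Finset.sum_congr rfl fun i _ => hrow r i
  have he1 : ∀ i, T.numEntry 1 (i + 1) = T'.numEntry 1 (i + 1) := by
    intro i
    have h1 := hs.card_le (i + 1)
    have h2 := hs'.card_le (i + 1)
    have h3 := congrFun hm (.soc i)
    have h4 := hsym (i + 1)
    simp only [mult, Nat.add_one_sub_one] at h1 h2 h3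
    omega
  have he2 : ∀ i, T.numEntry 2 (i + 1) = T'.numEntry 2 (i + 1) := by
    intro i
    rw [numEntry_eq_sum hs, numEntry_eq_sum hs']
    exact Finset.sum_congr rfl fun r _ => hrow r i
  -- Downward induction with `columns_identity`, starting below both diagrams.
  have hg2 : ∀ i, (T.γ 2).rowLen i = (T'.γ 2).rowLen i := by
    have step : ∀ i, (T.γ 2).rowLen (i + 1) = (T'.γ 2).rowLen (i + 1) →
        (T.γ 2).rowLen i = (T'.γ 2).rowLen i := by
      intro i hi
      have h1 := h.columns_identity hT i
      have h2 := h'.columns_identity hT' i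
      have h3 := congrFun hm (.emb i)
      simp only [mult] at h3
      have h4 : T.numSymbolInRow 2 (i + 1) (i + 2) = T'.numSymbolInRow 2 (i + 1) (i + 2) :=
        hrow (i + 1) (i + 1)
      rw [h3, he1, he2, hi, h4] at h1
      omega
    have big : ∀ i, max ((T.γ 2).colLen 0) ((T'.γ 2).colLen 0) ≤ i →
        (T.γ 2).rowLen i = (T'.γ 2).rowLen i := by
      intro i hi
      rw [(T.γ 2).rowLen_eq_zero ((le_max_left _ _).trans hi),
        (T'.γ 2).rowLen_eq_zero ((le_max_right _ _).trans hi)]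
    intro i
    rcases le_total (max ((T.γ 2).colLen 0) ((T'.γ 2).colLen 0)) i with hi | hi
    · exact big i hi
    · exact Nat.decreasingInduction (fun k _ ih => step k ih) (big _ le_rfl) hi
  have hg1 : ∀ i, (T.γ 1).rowLen i = (T'.γ 1).rowLen i := by
    intro i
    have h1 := he2 i
    have h2 := h.isLR.rowLen_mono one_le_two i
    have h3 := h'.isLR.rowLen_mono one_le_two i
    have h4 := hg2 i
    rw [numEntry_succ, numEntry_succ] at h1
    simp only [Nat.add_one_sub_one] at h1
    omega
  have hg0 : ∀ i, (T.γ 0).rowLen i = (T'.γ 0).rowLen i := by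
    intro i
    have h1 := he1 i
    have h2 := h.isLR.rowLen_mono zero_le_one i
    have h3 := h'.isLR.rowLen_mono zero_le_one i
    have h4 := hg1 i
    rw [numEntry_succ, numEntry_succ] at h1
    simp only [Nat.sub_self] at h1
    omega
  have hγ : T.γ = T'.γ := by
    funext l
    rcases Nat.lt_or_ge l 2 with hl | hl
    · interval_cases l
      · exact YoungDiagram.ext_rowLen hg0
      · exact YoungDiagram.ext_rowLen hg1
    · rw [γ_eq_of_entriesAtMost h.isLR.mono hT hl, γ_eq_of_entriesAtMost h'.isLR.mono hT' hl]
      exact YoungDiagram.ext_rowLen hg2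
  have hstripe : ∀ l, T.stripe l = T'.stripe l := fun l => by rw [stripe, stripe, hγ]
  refine TableauData.ext hγ (funext fun l => funext fun b => ?_)
  by_cases hb : 2 ≤ l ∧ b ∈ T.stripe l
  · obtain rfl : l = 2 := by
      by_contra hne
      have := hT l (by omega)
      rw [this] at hb
      exact absurd hb.2 (Finset.notMem_empty b)
    obtain ⟨i, j⟩ := b
    refine eq_of_forall_ge_iff fun r => ?_
    rw [subscript_le_iff hs hb.2, subscript_le_iff hs' (by rw [← hstripe]; exact hb.2), hg1]
    simp only [hrow]
  · rw [h.dummy l b hb, h'.dummy l b (by rw [← hstripe]; exact hb)]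

end TableauData

/-! ### Row counts of a single shape -/

namespace Shape

/-- The number of boxes with entry `1` in row `i` (counted from `0`). -/
def oneRow : Shape → ℕ → ℕ
  | emb _, _ => 0
  | soc t, i => if t = i then 1 else 0
  | two s _, i => if s = i then 1 else 0

/-- The number of boxes with symbol `2_(r+1)` in row `i` (counted from `0`). -/
def twoRow : Shape → ℕ → ℕ → ℕ
  | two s d, r, i => if s = r ∧ s + 1 + d = i then 1 else 0
  | _, _, _ => 0

/-- The number of boxes with symbol `2_(r+1)`. -/
def twoCount : Shape → ℕ → ℕ
  | two s _, r => if s = r then 1 else 0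
  | _, _ => 0

theorem row_zero_add_oneRow (σ : Shape) (i : ℕ) : σ.row 0 i + σ.oneRow i = σ.row 1 i := by
  rcases σ with t | t | ⟨s, _ | d⟩ <;> simp only [row, oneRow] <;> grind

theorem row_one_le_row_two (σ : Shape) (i : ℕ) : σ.row 1 i ≤ σ.row 2 i := by
  rcases σ with t | t | ⟨s, _ | d⟩ <;> simp only [row] <;> grind

theorem row_one_succ_le (σ : Shape) (i : ℕ) : σ.row 1 (i + 1) ≤ σ.row 0 i := by
  rcases σ with t | t | ⟨s, _ | d⟩ <;> simp only [row] <;> grind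

theorem row_two_succ_le (σ : Shape) (i : ℕ) : σ.row 2 (i + 1) ≤ σ.row 1 i := by
  rcases σ with t | t | ⟨s, _ | d⟩ <;> simp only [row] <;> grind

theorem subRow_zero (σ : Shape) (i : ℕ) : σ.subRow 0 i = σ.row 1 i := by
  rcases σ with t | t | ⟨s, d⟩ <;> simp [subRow, row]

theorem subRow_add_twoRow (σ : Shape) (r i : ℕ) :
    σ.subRow r i + σ.twoRow r i = σ.subRow (r + 1) i := by
  rcases σ with t | t | ⟨s, _ | d⟩ <;> simp only [subRow, row, twoRow] <;> grind

theorem subRow_self (σ : Shape) (i : ℕ) : σ.subRow i i = σ.row 2 i := by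
  rcases σ with t | t | ⟨s, _ | d⟩ <;> simp only [subRow, row] <;> grind

/-- The source of condition (iii): a box of row `i + 1` beyond row `i` of `γ^0` is not in `γ^{2,i}`,
so its subscript exceeds `i`. -/
theorem subRow_succ_le (σ : Shape) (i : ℕ) : σ.subRow i (i + 1) ≤ σ.row 0 i := by
  rcases σ with t | t | ⟨s, _ | d⟩ <;> simp only [subRow, row] <;> grind

theorem oneRow_eq (σ : Shape) (i : ℕ) :
    σ.oneRow i = (if σ = soc i then 1 else 0) + σ.twoCount i := by
  rcases σ with t | t | ⟨s, d⟩ <;> simp [oneRow, twoCount]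

theorem twoRow_eq (σ : Shape) (s d : ℕ) :
    σ.twoRow s (s + d + 1) = if σ = two s d then 1 else 0 := by
  rcases σ with t | t | ⟨s', d'⟩ <;> simp only [twoRow] <;> grind

theorem sum_twoRow {σ : Shape} {M : ℕ} (hM : ∀ i, 0 < σ.row 2 i → i < M) (r : ℕ) :
    ∑ i ∈ Finset.range M, σ.twoRow r i = σ.twoCount r := by
  rcases σ with t | t | ⟨s, d⟩
  · simp [twoRow, twoCount]
  · simp [twoRow, twoCount]
  · have h : s + 1 + d < M := hM _ (by rcases d with _ | d <;> simp only [row] <;> grind)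
    simp only [twoRow, twoCount, ite_and]
    by_cases hs : s = r
    · subst hs
      simp [h]
    · simp [hs]

/-- The counterpart of `columns_identity` for one shape; comparing the two after summation isolates
the number of summands `emb i`. -/
theorem row_identity (σ : Shape) (i : ℕ) :
    σ.row 1 i + σ.twoRow i (i + 1) =
      (if σ = emb i then 1 else 0) + σ.oneRow i + σ.row 2 (i + 1) := by
  rcases σ with t | t | ⟨s, _ | d⟩ <;> simp only [row, twoRow, oneRow] <;> grind

end Shape

/-! ### The Klein tableau of a direct sum of standard objects -/

namespace PEmb

section Invariance

variable {R : Type u} [CommRing R] {p : R}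

theorem map_kleinSub {B B' : Type u} [AddCommGroup B] [Module R B] [AddCommGroup B'] [Module R B']
    (e : B ≃ₗ[R] B') (A : Submodule R B) (l r : ℕ) :
    (kleinSub p A l r).map (e : B →ₗ[R] B') =
      kleinSub p (A.map (e : B →ₗ[R] B')) l r := by
  rw [kleinSub, kleinSub, Submodule.map_sup, Submodule.map_pointwise_smul,
    Submodule.map_pointwise_smul, Submodule.map_inf _ e.injective, Submodule.map_pointwise_smul,
    Submodule.map_pointwise_smul, Submodule.map_top, LinearMap.range_eq_top.mpr e.surjective]

theorem kleinSub_pi {n : ℕ} {F : Fin n → Type u} [∀ i, AddCommGroup (F i)]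
    [∀ i, Module R (F i)] (A : ∀ i, Submodule R (F i)) (l r : ℕ) :
    kleinSub p (Submodule.pi Set.univ A) l r =
      Submodule.pi Set.univ fun i => kleinSub p (A i) l r := by
  simp only [kleinSub]
  rw [← submodule_pi_top, smul_submodule_pi, smul_submodule_pi, smul_submodule_pi,
    inf_submodule_pi, smul_submodule_pi, sup_submodule_pi]

variable [IsDomain R] [IsPrincipalIdealRing R] [Fact (Prime p)]

theorem layerDim_quotient_of_equiv_pi {B : Type u} [AddCommGroup B] [Module R B]
    (h : IsPModule p B) {n : ℕ} {F : Fin n → Type u} [∀ i, AddCommGroup (F i)]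
    [∀ i, Module R (F i)] (hF : ∀ j, IsPModule p (F j)) (e : B ≃ₗ[R] ∀ j, F j) (N : Submodule R B)
    (N' : ∀ j, Submodule R (F j))
    (hN : N.map (e : B →ₗ[R] ∀ j, F j) = Submodule.pi Set.univ N') (i : ℕ) :
    layerDim p (B ⧸ N) i = ∑ j, layerDim p (F j ⧸ N' j) i := by
  rw [← layerDim_quotient_pi hF N']
  exact (layerDim_congr (h.quotient _) (Submodule.Quotient.equiv _ _ e hN) i).symm

theorem rowLen_lrPart_of_iso {E : PEmb R p} {n : ℕ} {σ : Fin n → Shape}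
    (h : E.Iso (directSum fun i => std R p (σ i))) (l i : ℕ) :
    (E.lrPart l).rowLen i = ∑ j, (σ j).row l i := by
  obtain ⟨e, he⟩ := h
  rw [lrPart, rowLen_moduleType]
  refine (layerDim_quotient_of_equiv_pi (F := fun j => (std R p (σ j)).B) E.isPModule
    (fun j => (std R p (σ j)).isPModule) e _ (fun j => p ^ l • (std R p (σ j)).A) ?_ i).trans
    (Finset.sum_congr rfl fun j _ => layerDim_std (σ j) l i)
  refine (Submodule.map_pointwise_smul _ _ _).trans ?_
  exact (congrArg (p ^ l • ·) he).trans (smul_submodule_pi _ _)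

theorem rowLen_kleinPart_of_iso {E : PEmb R p} {n : ℕ} {σ : Fin n → Shape}
    (h : E.Iso (directSum fun i => std R p (σ i))) (r i : ℕ) :
    (E.kleinPart 2 r).rowLen i = ∑ j, (σ j).subRow r i := by
  obtain ⟨e, he⟩ := h
  rw [kleinPart, rowLen_moduleType]
  refine (layerDim_quotient_of_equiv_pi (F := fun j => (std R p (σ j)).B) E.isPModule
    (fun j => (std R p (σ j)).isPModule) e _ (fun j => kleinSub p (std R p (σ j)).A 2 r) ?_ i).trans
    (Finset.sum_congr rfl fun j _ => layerDim_std_kleinSub (σ j) r i)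
  refine (map_kleinSub e E.A 2 r).trans ?_
  exact (congrArg (fun A => kleinSub p A 2 r) he).trans (kleinSub_pi _ _ _)

theorem kleinPart_of_three_le {E : PEmb R p} (hE : E.InS2) {l : ℕ} (hl : 3 ≤ l) (r r' : ℕ) :
    E.kleinPart l r = E.kleinPart l r' := by
  refine YoungDiagram.ext_rowLen fun i => ?_
  rw [kleinPart, kleinPart, rowLen_moduleType, rowLen_moduleType]
  have h : kleinSub p E.A l r = kleinSub p E.A l r' := by
    rw [kleinSub_of_three_le hE hl, kleinSub_of_three_le hE hl]
  exact congrArg (fun N : Submodule R E.B => layerDim p (E.B ⧸ N) i) h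

theorem klein_φ_of_three_le {E : PEmb R p} (hE : E.InS2) {l : ℕ} (hl : 3 ≤ l) (b : ℕ × ℕ) :
    E.klein.φ l b = 0 := by
  change sInf {r : ℕ | 2 ≤ l ∧ 1 ≤ r ∧
    b ∈ (E.kleinPart l r).cells \ (E.kleinPart l (r - 1)).cells} = 0
  simp [kleinPart_of_three_le hE hl _ 0]

end Invariance

section Klein

variable {R : Type u} [CommRing R] [IsDomain R] [IsPrincipalIdealRing R] {p : R} [Fact (Prime p)]
  {E : PEmb R p} {n : ℕ} {σ : Fin n → Shape}

theorem klein_rowLen (h : E.Iso (directSum fun i => std R p (σ i))) (l i : ℕ) :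
    (E.klein.γ l).rowLen i = ∑ j, (σ j).row l i :=
  rowLen_lrPart_of_iso h l i

theorem mem_klein_stripe_two (h : E.Iso (directSum fun i => std R p (σ i))) {i j : ℕ} :
    (i, j) ∈ E.klein.stripe 2 ↔ ∑ k, (σ k).row 1 i ≤ j ∧ j < ∑ k, (σ k).row 2 i := by
  rw [TableauData.mem_stripe, klein_rowLen h, klein_rowLen h]

theorem sum_subRow_mono (σ : Fin n → Shape) (i : ℕ) :
    Monotone fun r => ∑ k, (σ k).subRow r i :=
  monotone_nat_of_le_succ fun r => Finset.sum_le_sum fun k _ => by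
    rw [← Shape.subRow_add_twoRow]
    exact Nat.le_add_right _ _

/-- In a fixed row the lengths of `γ^{2,r}` increase with `r` from that of `γ^1` to that of `γ^2`,
so a box of the stripe enters at exactly one `r ≥ 1`, and the infimum defining `φ` is over a
singleton. -/
theorem klein_φ_le_iff (h : E.Iso (directSum fun i => std R p (σ i))) {i j : ℕ}
    (hij : (i, j) ∈ E.klein.stripe 2) (r : ℕ) :
    E.klein.φ 2 (i, j) ≤ r ↔ j < ∑ k, (σ k).subRow r i := by
  classical
  rw [mem_klein_stripe_two h] at hij
  have hex : ∃ r, j < ∑ k, (σ k).subRow r i := ⟨i, by simpa only [Shape.subRow_self] using hij.2⟩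
  have hpos : 1 ≤ Nat.find hex := by
    rw [Nat.one_le_iff_ne_zero]
    intro h0
    have := Nat.find_spec hex
    rw [h0] at this
    simp only [Shape.subRow_zero] at this
    omega
  have hmono := sum_subRow_mono σ i
  have hset : {r : ℕ | 2 ≤ 2 ∧ 1 ≤ r ∧
      (i, j) ∈ (E.kleinPart 2 r).cells \ (E.kleinPart 2 (r - 1)).cells} = {Nat.find hex} := by
    ext r
    rw [Set.mem_ofPred_eq, Set.mem_singleton_iff, Finset.mem_sdiff, YoungDiagram.mem_cells,
      YoungDiagram.mem_cells, YoungDiagram.mem_iff_lt_rowLen, YoungDiagram.mem_iff_lt_rowLen,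
      rowLen_kleinPart_of_iso h, rowLen_kleinPart_of_iso h]
    constructor
    · rintro ⟨-, h1, h2, h3⟩
      refine le_antisymm ?_ (Nat.find_min' hex h2)
      by_contra! hlt
      exact h3 ((Nat.find_spec hex).trans_le (hmono (by omega)))
    · rintro rfl
      exact ⟨le_rfl, hpos, Nat.find_spec hex, Nat.find_min hex (by omega)⟩
  have hφ : E.klein.φ 2 (i, j) = Nat.find hex := by
    change sInf {r : ℕ | 2 ≤ 2 ∧ 1 ≤ r ∧
      (i, j) ∈ (E.kleinPart 2 r).cells \ (E.kleinPart 2 (r - 1)).cells} = _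
    rw [hset, csInf_singleton]
  rw [hφ]
  exact ⟨fun hr => (Nat.find_spec hex).trans_le (hmono hr), fun hr => Nat.find_min' hex hr⟩

theorem klein_numEntry_one (h : E.Iso (directSum fun i => std R p (σ i))) (i : ℕ) :
    E.klein.numEntry 1 (i + 1) = ∑ k, (σ k).oneRow i := by
  rw [TableauData.numEntry_succ, klein_rowLen h, klein_rowLen h]
  simp only [← Shape.row_zero_add_oneRow, Finset.sum_add_distrib, Nat.sub_self]
  omega

theorem klein_numSymbolInRow_succ (h : E.Iso (directSum fun i => std R p (σ i))) (r i : ℕ) :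
    E.klein.numSymbolInRow 2 (r + 1) (i + 1) = ∑ k, (σ k).twoRow r i := by
  have hsum : ∑ k, (σ k).subRow r i + ∑ k, (σ k).twoRow r i = ∑ k, (σ k).subRow (r + 1) i := by
    rw [← Finset.sum_add_distrib]
    simp only [Shape.subRow_add_twoRow]
  have hset : ((Finset.Ico ((E.klein.γ (2 - 1)).rowLen i) ((E.klein.γ 2).rowLen i)).filter
      fun j => E.klein.φ 2 (i, j) = r + 1) =
      Finset.Ico (∑ k, (σ k).subRow r i) (∑ k, (σ k).subRow (r + 1) i) := by
    ext j
    have hmono := sum_subRow_mono σ i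
    rw [Finset.mem_filter, Finset.mem_Ico, ← TableauData.mem_stripe, Finset.mem_Ico]
    constructor
    · rintro ⟨hj, hφ⟩
      have h1 := klein_φ_le_iff h hj r
      have h2 := klein_φ_le_iff h hj (r + 1)
      omega
    · rintro ⟨h1, h2⟩
      have hj : (i, j) ∈ E.klein.stripe 2 := by
        rw [mem_klein_stripe_two h]
        have h3 := hmono (Nat.zero_le r)
        have h4 := hmono (Nat.le_add_right (r + 1) i)
        have h5 : ∑ k, (σ k).subRow (r + 1 + i) i = ∑ k, (σ k).row 2 i := by
          refine Finset.sum_congr rfl fun k _ => ?_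
          rcases σ k with t | t | ⟨s, _ | d⟩ <;> simp only [Shape.subRow, Shape.row] <;> grind
        simp only [Shape.subRow_zero] at h3
        simp only [h5] at h4
        omega
      have h1' := klein_φ_le_iff h hj r
      have h2' := klein_φ_le_iff h hj (r + 1)
      exact ⟨hj, by omega⟩
  rw [TableauData.numSymbolInRow_succ, hset, Nat.card_Ico]
  omega

theorem klein_numSymbol_succ (h : E.Iso (directSum fun i => std R p (σ i))) (r : ℕ) :
    E.klein.numSymbol 2 (r + 1) = ∑ k, (σ k).twoCount r := by
  rw [E.klein.numSymbol_eq_sum 2 (r + 1) le_rfl]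
  simp only [klein_numSymbolInRow_succ h]
  rw [Finset.sum_comm]
  refine Finset.sum_congr rfl fun k _ => Shape.sum_twoRow (fun i hi => ?_) r
  by_contra! hle
  have h0 := (E.klein.γ 2).rowLen_eq_zero hle
  rw [klein_rowLen h, Finset.sum_eq_zero_iff] at h0
  have := h0 k (Finset.mem_univ k)
  omega

theorem klein_numSymbol_zero (h : E.Iso (directSum fun i => std R p (σ i))) :
    E.klein.numSymbol 2 0 = 0 := by
  rw [TableauData.numSymbol, Finset.card_eq_zero, Finset.filter_eq_empty_iff]
  rintro ⟨i, j⟩ hb h0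
  have h1 := (klein_φ_le_iff h hb 0).mp h0.le
  rw [mem_klein_stripe_two h] at hb
  simp only [Shape.subRow_zero] at h1
  omega

theorem klein_γ_of_two_le (h : E.Iso (directSum fun i => std R p (σ i))) {l : ℕ} (hl : 2 ≤ l) :
    E.klein.γ l = E.klein.γ 2 := by
  refine YoungDiagram.ext_rowLen fun i => ?_
  rw [klein_rowLen h, klein_rowLen h]
  exact Finset.sum_congr rfl fun k _ => (σ k).row_of_two_le hl i

theorem klein_entriesAtMost (h : E.Iso (directSum fun i => std R p (σ i))) :
    E.klein.EntriesAtMost 2 := by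
  intro l hl
  rw [TableauData.stripe, klein_γ_of_two_le h hl.le, klein_γ_of_two_le h (by omega : 2 ≤ l - 1),
    Finset.sdiff_self]

theorem klein_monotone (h : E.Iso (directSum fun i => std R p (σ i))) : Monotone E.klein.γ := by
  refine monotone_nat_of_le_succ fun l => ?_
  rcases l with _ | _ | l
  · refine YoungDiagram.le_of_rowLen_le fun i => ?_
    rw [klein_rowLen h, klein_rowLen h]
    refine Finset.sum_le_sum fun k _ => ?_
    rw [zero_add, ← Shape.row_zero_add_oneRow]
    exact Nat.le_add_right _ _
  · refine YoungDiagram.le_of_rowLen_le fun i => ?_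
    rw [klein_rowLen h, klein_rowLen h]
    exact Finset.sum_le_sum fun k _ => (σ k).row_one_le_row_two i
  · rw [klein_γ_of_two_le h (by omega), klein_γ_of_two_le h (by omega : 2 ≤ l + 1 + 1 + 1)]

theorem klein_rowLen_succ_le (h : E.Iso (directSum fun i => std R p (σ i))) (l : ℕ) (hl : 1 ≤ l)
    (i : ℕ) : (E.klein.γ l).rowLen (i + 1) ≤ (E.klein.γ (l - 1)).rowLen i := by
  rw [klein_rowLen h, klein_rowLen h]
  refine Finset.sum_le_sum fun k _ => ?_
  rcases l with _ | _ | _ | l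
  · omega
  · exact (σ k).row_one_succ_le i
  · exact (σ k).row_two_succ_le i
  · rw [(σ k).row_of_two_le (by omega), (σ k).row_of_two_le (by omega : 2 ≤ l + 1 + 1 + 1 - 1)]
    exact ((σ k).row_two_succ_le i).trans ((σ k).row_one_le_row_two i)

/-- Each condition is an inequality of row counts valid shape by shape; for (iv), every `two s d`
supplies its own entry 1 in row `s + 1`. -/
theorem klein_isSubscriptFunction_two (h : E.Iso (directSum fun i => std R p (σ i))) :
    E.klein.IsSubscriptFunction 2 where
  row_mono i j j' hj hj' hle := by
    rw [klein_φ_le_iff h hj]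
    exact hle.trans_lt ((klein_φ_le_iff h hj' _).mp le_rfl)
  lt_row i j hj := by
    rw [Nat.lt_succ_iff, klein_φ_le_iff h hj]
    simp only [Shape.subRow_self]
    exact ((mem_klein_stripe_two h).mp hj).2
  eq_of_above i j hj hj' := by
    rw [TableauData.mem_stripe, Nat.add_one_sub_one, klein_rowLen h] at hj'
    refine le_antisymm ?_ (Nat.lt_of_not_le ?_)
    · rw [klein_φ_le_iff h hj]
      simp only [Shape.subRow_self]
      exact ((mem_klein_stripe_two h).mp hj).2
    · rw [klein_φ_le_iff h hj, not_lt]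
      exact (Finset.sum_le_sum fun k _ => (σ k).subRow_succ_le i).trans hj'.1
  card_le r := by
    rcases r with _ | r
    · rw [klein_numSymbol_zero h]
      exact Nat.zero_le _
    · rw [klein_numSymbol_succ h, Nat.add_one_sub_one, klein_numEntry_one h]
      refine Finset.sum_le_sum fun k _ => ?_
      rw [Shape.oneRow_eq]
      exact Nat.le_add_left _ _

theorem klein_isKlein (hE : E.InS2) (h : E.Iso (directSum fun i => std R p (σ i))) :
    E.klein.IsKlein := by
  have hs := klein_isSubscriptFunction_two h
  have hempty := klein_entriesAtMost h
  refine ⟨⟨klein_monotone h, ⟨2, fun l hl => klein_γ_of_two_le h hl⟩,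
    fun l hl => YoungDiagram.colLen_le_succ_iff.mpr (klein_rowLen_succ_le h l hl),
    fun l hl k => ?_⟩, fun l hl => ?_, fun l b hb => ?_⟩
  · rcases hl.eq_or_lt with rfl | hl
    · exact TableauData.card_filter_stripe_two_le (klein_rowLen_succ_le h) hs k
    · rw [hempty l hl]
      exact Nat.zero_le _
  · rcases hl.eq_or_lt with rfl | hl
    · exact hs
    · have hnot : ∀ b, b ∉ E.klein.stripe l := by
        rw [hempty l hl]
        exact Finset.notMem_empty
      refine ⟨fun i j j' hj => absurd hj (hnot _), fun i j hj => absurd hj (hnot _),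
        fun i j hj => absurd hj (hnot _), fun r => ?_⟩
      rw [TableauData.numSymbol, hempty l hl]
      exact Nat.zero_le _
  · by_cases hl : 3 ≤ l
    · exact klein_φ_of_three_le hE hl b
    · change sInf {r : ℕ | 2 ≤ l ∧ 1 ≤ r ∧
        b ∈ (E.kleinPart l r).cells \ (E.kleinPart l (r - 1)).cells} = 0
      by_cases hl2 : 2 ≤ l
      · obtain rfl : l = 2 := by omega
        -- Outside the stripe no `r` qualifies, since every `γ^{2,r}` lies between `γ^1` and `γ^2`;
        -- the infimum of the empty set is the dummy value 0.
        convert Nat.sInf_empty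
        rw [Set.eq_empty_iff_forall_notMem]
        rintro r ⟨-, hr, hbr⟩
        obtain ⟨i, j⟩ := b
        rw [Finset.mem_sdiff, YoungDiagram.mem_cells, YoungDiagram.mem_cells,
          YoungDiagram.mem_iff_lt_rowLen, YoungDiagram.mem_iff_lt_rowLen,
          rowLen_kleinPart_of_iso h, rowLen_kleinPart_of_iso h] at hbr
        refine hb ⟨le_rfl, (mem_klein_stripe_two h).mpr ?_⟩
        have h3 := sum_subRow_mono σ i (Nat.zero_le (r - 1))
        have h5 : ∑ k, (σ k).subRow r i ≤ ∑ k, (σ k).row 2 i := by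
          refine Finset.sum_le_sum fun k _ => ?_
          rcases σ k with t | t | ⟨s, _ | d⟩ <;> simp only [Shape.subRow, Shape.row] <;> grind
        simp only [Shape.subRow_zero] at h3
        omega
      · simp [hl2]

theorem klein_mult (hE : E.InS2) (h : E.Iso (directSum fun i => std R p (σ i))) (τ : Shape) :
    E.klein.mult τ = (Finset.univ.filter fun i => σ i = τ).card := by
  rw [Finset.card_filter]
  rcases τ with t | t | ⟨s, d⟩
  -- The number of empty boxes is not computed: it is the only unknown when the tableau identity is
  -- compared with the summed identity for shapes.
  · have h1 := (klein_isKlein hE h).columns_identity (klein_entriesAtMost h) t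
    have h2 : ∑ k, ((σ k).row 1 t + (σ k).twoRow t (t + 1)) = ∑ k,
      ((if σ k = .emb t then 1 else 0) + (σ k).oneRow t + (σ k).row 2 (t + 1)) :=
      Finset.sum_congr rfl fun k _ => (σ k).row_identity t
    have h3 : ∑ k, (σ k).row 1 t ≤ ∑ k, (σ k).row 2 t :=
      Finset.sum_le_sum fun k _ => (σ k).row_one_le_row_two t
    rw [klein_numEntry_one h, klein_numSymbolInRow_succ h, TableauData.numEntry_succ,
      klein_rowLen h, klein_rowLen h, klein_rowLen h, Nat.add_one_sub_one] at h1
    simp only [Finset.sum_add_distrib] at h2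
    simp only [TableauData.mult]
    omega
  · simp only [TableauData.mult, klein_numEntry_one h, klein_numSymbol_succ h, Shape.oneRow_eq,
      Finset.sum_add_distrib, Nat.add_sub_cancel]
  · simp only [TableauData.mult]
    rw [klein_numSymbolInRow_succ h]
    exact Finset.sum_congr rfl fun k _ => (σ k).twoRow_eq s d

end Klein

end PEmb

/-! ### Finite families with prescribed multiplicities -/

theorem exists_equiv_of_card_fiber_eq {n n' : ℕ} {σ : Fin n → Shape} {σ' : Fin n' → Shape}
    (h : ∀ τ, (Finset.univ.filter fun i => σ i = τ).card =
      (Finset.univ.filter fun i => σ' i = τ).card) :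
    ∃ e : Fin n ≃ Fin n', ∀ i, σ' (e i) = σ i := by
  have hc : ∀ τ, Nonempty ({i // σ i = τ} ≃ {i // σ' i = τ}) := fun τ => by
    rw [← Fintype.card_eq, Fintype.card_subtype, Fintype.card_subtype, h]
  let f := fun τ => Classical.choice (hc τ)
  refine ⟨(Equiv.sigmaFiberEquiv σ).symm.trans
    ((Equiv.sigmaCongrRight f).trans (Equiv.sigmaFiberEquiv σ')), fun i => ?_⟩
  exact (f (σ i) ⟨i, rfl⟩).2

theorem exists_family_of_finite_support {f : Shape → ℕ} (hf : (Function.support f).Finite) :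
    ∃ (n : ℕ) (σ : Fin n → Shape), ∀ τ, (Finset.univ.filter fun i => σ i = τ).card = f τ := by
  let m : Multiset Shape := Finsupp.toMultiset (Finsupp.ofSupportFinite f hf)
  let v : List.Vector Shape m.toList.length := ⟨m.toList, rfl⟩
  refine ⟨_, v.get, fun τ => ?_⟩
  rw [Fin.card_filter_univ_eq_vector_get_eq_count τ v]
  change m.toList.count τ = f τ
  rw [← Multiset.coe_count, Multiset.coe_toList, Finsupp.count_toMultiset]
  rfl

theorem TableauData.IsKlein.finite_support_mult {T : TableauData} (h : T.IsKlein)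
    (hT : T.EntriesAtMost 2) : (Function.support T.mult).Finite := by
  set M := (T.γ 2).colLen 0
  have h0 : ∀ i, M ≤ i → (T.γ 2).rowLen i = 0 := fun i hi => (T.γ 2).rowLen_eq_zero hi
  refine (((Set.finite_Iio M).image Shape.emb).union (((Set.finite_Iio M).image Shape.soc).union
    (((Set.finite_Iio M).prod (Set.finite_Iio M)).image fun x => Shape.two x.1 x.2))).subset ?_
  intro τ hτ
  have key : ∀ i, M ≤ i → (T.γ 0).rowLen i = 0 ∧ (T.γ 1).rowLen i = 0 := fun i hi => by
    have h1 := h.isLR.rowLen_mono zero_le_one i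
    have h2 := h.isLR.rowLen_mono one_le_two i
    rw [h0 i hi] at h2
    omega
  rcases τ with t | t | ⟨s, d⟩
  · refine Or.inl ⟨t, ?_, rfl⟩
    by_contra! ht
    have ht : M ≤ t := not_lt.mp ht
    refine hτ ?_
    simp only [mult]
    rw [numEmptyCol_succ h.isLR hT, numEmptyAbove_succ, h0 (t + 1) (by omega), (key t ht).1]
    simp
  · refine Or.inr (Or.inl ⟨t, ?_, rfl⟩)
    by_contra! ht
    have ht : M ≤ t := not_lt.mp ht
    refine hτ ?_
    simp only [mult]
    rw [numEntry_succ, (key t ht).2]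
    simp
  · have hlt : s + d + 1 < M := by
      by_contra! ht
      refine hτ ?_
      simp only [mult]
      rw [numSymbolInRow_succ, h0 _ ht]
      simp
    exact Or.inr (Or.inr ⟨(s, d), ⟨Set.mem_Iio.mpr (by omega), Set.mem_Iio.mpr (by omega)⟩, rfl⟩)

/-! ### Formal properties of direct sums -/

namespace PEmb

section Sums

variable {R : Type u} [CommRing R] {p : R}

theorem iso_directSum_succ {n : ℕ} (G : Fin (n + 1) → PEmb R p) :
    ((G 0).prod (directSum fun i => G i.succ)).Iso (directSum G) := by
  refine ⟨Fin.consLinearEquiv R fun i => (G i).B, le_antisymm ?_ ?_⟩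
  · rintro _ ⟨⟨x, y⟩, ⟨hx, hy⟩, rfl⟩
    refine (Submodule.mem_pi (R := R) (φ := fun i => (G i).B)).mpr fun i _ => ?_
    refine Fin.cases ?_ (fun i => ?_) i
    · exact hx
    · exact hy i trivial
  · intro z hz
    refine ⟨(z 0, fun i => z i.succ), ⟨hz 0 trivial, fun i _ => hz i.succ trivial⟩, ?_⟩
    exact Fin.cons_self_tail z

theorem iso_directSum_congr {n n' : ℕ} {F : Fin n → PEmb R p} {G : Fin n' → PEmb R p}
    (e : Fin n ≃ Fin n') (h : ∀ i, (F i).Iso (G (e i))) : (directSum F).Iso (directSum G) := by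
  choose f hf using h
  let g : (∀ i, (F i).B) ≃ₗ[R] ∀ i, (G i).B :=
    (LinearEquiv.piCongrRight f).trans (LinearEquiv.piCongrLeft R (fun i => (G i).B) e)
  have hg : ∀ (x : ∀ i, (F i).B) i, g x (e i) = f i (x i) := fun x i =>
    Equiv.piCongrLeft_apply_apply (fun i => (G i).B) e (fun i => f i (x i)) i
  refine ⟨g, le_antisymm ?_ ?_⟩
  · rintro _ ⟨x, hx, rfl⟩ i -
    obtain ⟨i, rfl⟩ := e.surjective i
    have h1 : f i (x i) ∈ (G (e i)).A := by
      rw [← hf]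
      exact ⟨x i, hx i trivial, rfl⟩
    exact (congrArg (· ∈ (G (e i)).A) (hg x i)).mpr h1
  · intro y hy
    have hy' : ∀ i, ∃ x ∈ (F i).A, f i x = y (e i) := fun i => by
      have := hy (e i) trivial
      change y (e i) ∈ (G (e i)).A at this
      rw [← hf] at this
      exact this
    choose x hx hxy using hy'
    refine ⟨x, fun i _ => hx i, funext fun i => ?_⟩
    obtain ⟨i, rfl⟩ := e.surjective i
    exact (hg x i).trans (hxy i)

theorem Iso.prod {E E' F F' : PEmb R p} (h : E.Iso E') (h' : F.Iso F') :
    (E.prod F).Iso (E'.prod F') := by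
  obtain ⟨e, he⟩ := h
  obtain ⟨f, hf⟩ := h'
  refine ⟨e.prodCongr f, le_antisymm ?_ ?_⟩
  · rintro _ ⟨⟨x, y⟩, ⟨hx, hy⟩, rfl⟩
    refine ⟨?_, ?_⟩
    · change e x ∈ E'.A
      rw [← he]
      exact ⟨x, hx, rfl⟩
    · change f y ∈ F'.A
      rw [← hf]
      exact ⟨y, hy, rfl⟩
  · rintro ⟨x, y⟩ ⟨hx, hy⟩
    change x ∈ E'.A at hx
    change y ∈ F'.A at hy
    rw [← he] at hx
    rw [← hf] at hy
    obtain ⟨x, hx, rfl⟩ := hx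
    obtain ⟨y, hy, rfl⟩ := hy
    exact ⟨(x, y), ⟨hx, hy⟩, rfl⟩

theorem iso_prod_left_comm (E F G : PEmb R p) :
    (E.prod (F.prod G)).Iso (F.prod (E.prod G)) := by
  let e : (E.B × F.B × G.B) ≃ₗ[R] F.B × E.B × G.B :=
    { toFun := fun x => (x.2.1, x.1, x.2.2)
      invFun := fun x => (x.2.1, x.1, x.2.2)
      map_add' := fun _ _ => rfl
      map_smul' := fun _ _ => rfl
      left_inv := fun _ => rfl
      right_inv := fun _ => rfl }
  refine ⟨e, le_antisymm ?_ ?_⟩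
  · rintro _ ⟨⟨x, y, z⟩, ⟨hx, hy, hz⟩, rfl⟩
    exact ⟨hy, hx, hz⟩
  · rintro ⟨y, x, z⟩ ⟨hy, hx, hz⟩
    exact ⟨(x, y, z), ⟨hx, hy, hz⟩, rfl⟩

theorem iso_prod_assoc (E F G : PEmb R p) :
    ((E.prod F).prod G).Iso (E.prod (F.prod G)) := by
  refine ⟨LinearEquiv.prodAssoc R E.B F.B G.B, le_antisymm ?_ ?_⟩
  · rintro _ ⟨⟨⟨x, y⟩, z⟩, ⟨⟨hx, hy⟩, hz⟩, rfl⟩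
    exact ⟨hx, hy, hz⟩
  · rintro ⟨x, y, z⟩ ⟨hx, hy, hz⟩
    exact ⟨((x, y), z), ⟨⟨hx, hy⟩, hz⟩, rfl⟩

theorem Iso.InS2 {E F : PEmb R p} (h : E.Iso F) (hE : E.InS2) : F.InS2 := by
  obtain ⟨e, he⟩ := h
  intro a ha
  rw [← he] at ha
  obtain ⟨a, ha, rfl⟩ := ha
  change p ^ 2 • e a = 0
  rw [← map_smul, hE a ha, map_zero]

theorem Iso.isZero {E F : PEmb R p} (h : E.Iso F) (hE : E.IsZero) : F.IsZero := by
  obtain ⟨e, -⟩ := h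
  have : Subsingleton E.B := hE
  exact e.symm.injective.subsingleton

theorem InS2.of_prod_left {E F : PEmb R p} (h : (E.prod F).InS2) : E.InS2 := fun a ha =>
  congrArg Prod.fst (h (a, 0) ⟨ha, F.A.zero_mem⟩)

theorem InS2.of_prod_right {E F : PEmb R p} (h : (E.prod F).InS2) : F.InS2 := fun a ha =>
  congrArg Prod.snd (h (0, a) ⟨E.A.zero_mem, ha⟩)

theorem InS2.directSum {n : ℕ} {F : Fin n → PEmb R p} (h : ∀ i, (F i).InS2) :
    (directSum F).InS2 :=
  fun a ha => funext fun i => h i (a i) (ha i trivial)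

theorem InS2.of_directSum {n : ℕ} {F : Fin n → PEmb R p} (h : (PEmb.directSum F).InS2) (i : Fin n) :
    (F i).InS2 := by
  classical
  intro a ha
  have h1 := h (Pi.single (M := fun i => (F i).B) i a) (by
    intro j _
    by_cases hj : j = i
    · subst hj
      change Pi.single (M := fun i => (F i).B) j a j ∈ _
      rwa [Pi.single_eq_same]
    · change Pi.single (M := fun i => (F i).B) i a j ∈ _
      rw [Pi.single_eq_of_ne hj]
      exact (F j).A.zero_mem)
  have h2 : p ^ 2 • Pi.single (M := fun i => (F i).B) i a i = 0 := congrFun h1 i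
  rwa [Pi.single_eq_same] at h2

theorem isZero_directSum_fin_zero (F : Fin 0 → PEmb R p) : (directSum F).IsZero :=
  ⟨fun _ _ => funext fun i => i.elim0⟩

theorem iso_of_isZero {E F : PEmb R p} (hE : E.IsZero) (hF : F.IsZero) : E.Iso F := by
  have : Subsingleton E.B := hE
  have : Subsingleton F.B := hF
  refine ⟨0, ?_⟩
  have : Subsingleton (Submodule R F.B) := inferInstance
  exact Subsingleton.elim _ _

theorem Iso.indecomposable {E F : PEmb R p} (h : E.Iso F) (hE : E.Indecomposable) :
    F.Indecomposable :=
  ⟨fun hF => hE.1 (h.symm.isZero hF), fun G H hGH => hE.2 G H (h.trans hGH)⟩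

theorem iso_directSum_single (E : PEmb R p) : E.Iso (directSum fun _ : Fin 1 => E) := by
  refine ⟨(LinearEquiv.funUnique (Fin 1) R E.B).symm, le_antisymm ?_ ?_⟩
  · rintro _ ⟨x, hx, rfl⟩ i -
    exact hx
  · intro y hy
    exact ⟨y 0, hy 0 trivial, funext fun i => congrArg y (Subsingleton.elim 0 i)⟩

end Sums

/-! ### Unique decomposition and the bijection -/

variable {R : Type u} [CommRing R] [IsDomain R] [IsPrincipalIdealRing R] {p : R} [Fact (Prime p)]

theorem not_isZero_std (σ : Shape) : ¬ (std R p σ).IsZero := by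
  intro h
  have hs : Subsingleton (std R p σ).B := h
  have hp : Prime p := Fact.out
  have key : ∀ m, ¬ Subsingleton (R ⧸ Ideal.span {p ^ (m + 1)}) := by
    intro m hm
    rw [Ideal.Quotient.subsingleton_iff, Ideal.span_singleton_eq_top] at hm
    exact hp.not_isUnit (isUnit_of_dvd_unit (dvd_pow_self p (Nat.succ_ne_zero m)) hm)
  rcases σ with t | t | ⟨s, _ | d⟩
  · exact key t hs
  · exact key t hs
  · exact key (s + 1) hs
  · exact key (s + d + 2) (Function.Surjective.subsingleton (α := (std R p (.two s (d + 1))).B)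
      (f := fun x => x.1) fun y => ⟨(y, 0), rfl⟩)

theorem exists_iso_directSum_std (E : PEmb R p) (hE : E.InS2) :
    ∃ (n : ℕ) (σ : Fin n → Shape), E.Iso (directSum fun i => std R p (σ i)) := by
  obtain ⟨N, hN⟩ : ∃ N : ℕ, Module.length R E.B ≤ N := by
    have := Module.length_ne_top_iff.mpr E.isPModule.finiteLength
    exact ⟨_, (ENat.natCast_toNat this).ge⟩
  induction N generalizing E with
  | zero =>
    have h0 : E.IsZero := Module.length_eq_zero_iff.mp (nonpos_iff_eq_zero.mp (by simpa using hN))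
    exact ⟨0, Fin.elim0, iso_of_isZero h0 (isZero_directSum_fin_zero _)⟩
  | succ N ih =>
    by_cases h0 : E.IsZero
    · exact ⟨0, Fin.elim0, iso_of_isZero h0 (isZero_directSum_fin_zero _)⟩
    obtain ⟨τ, E', h⟩ := exists_iso_std_prod E hE h0
    have hlen : Module.length R E.B = Module.length R (std R p τ).B + Module.length R E'.B := by
      obtain ⟨e, -⟩ := h
      rw [e.length_eq]
      exact Module.length_prod R _ _
    have hpos : 1 ≤ Module.length R (std R p τ).B := by
      rw [Order.one_le_iff_ne_zero, Ne, Module.length_eq_zero_iff]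
      exact not_isZero_std τ
    have hle : Module.length R E'.B ≤ N := by
      have h1 : 1 + Module.length R E'.B ≤ 1 + N := by
        calc _ ≤ Module.length R E.B := by rw [hlen]; gcongr
          _ ≤ _ := by rw [add_comm]; exact_mod_cast hN
      exact (ENat.add_le_add_iff_left ENat.one_ne_top).mp h1
    obtain ⟨n, σ, hσ⟩ := ih E' (h.InS2 hE).of_prod_right hle
    refine ⟨n + 1, Fin.cons τ σ, h.trans (((Iso.refl _).prod hσ).trans ?_)⟩
    exact iso_directSum_succ fun i => std R p ((Fin.cons τ σ : Fin (n + 1) → Shape) i)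

theorem InS2.of_iso_directSum_std {E : PEmb R p} {n : ℕ} {σ : Fin n → Shape}
    (h : E.Iso (PEmb.directSum fun i => std R p (σ i))) : E.InS2 :=
  h.symm.InS2 (InS2.directSum fun i => std_InS2 (σ i))

/-- Uniqueness of decompositions: both counts equal a multiplicity read off the tableau of `E`,
which involves no decomposition. -/
theorem card_fiber_eq_of_iso {E : PEmb R p} {n n' : ℕ} {σ : Fin n → Shape} {σ' : Fin n' → Shape}
    (h : E.Iso (directSum fun i => std R p (σ i)))
    (h' : E.Iso (directSum fun i => std R p (σ' i))) (τ : Shape) :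
    (Finset.univ.filter fun i => σ i = τ).card = (Finset.univ.filter fun i => σ' i = τ).card := by
  have hE := InS2.of_iso_directSum_std h
  rw [← klein_mult hE h, ← klein_mult hE h']

theorem eq_of_std_iso {σ τ : Shape} (h : (std R p σ).Iso (std R p τ)) : σ = τ := by
  obtain ⟨e, he⟩ := exists_equiv_of_card_fiber_eq
    (card_fiber_eq_of_iso (iso_directSum_single (std R p σ))
      (h.trans (iso_directSum_single (std R p τ))))
  exact (he 0).symm

/-- Two nonzero factors would each split off a standard object, giving a decomposition with at least
two summands besides the one with a single summand. -/
theorem indecomposable_std (σ : Shape) : (std R p σ).Indecomposable := by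
  refine ⟨not_isZero_std σ, fun F G h => ?_⟩
  by_contra! hcon
  have hFG := h.InS2 (std_InS2 σ)
  obtain ⟨τ, F', hF⟩ := exists_iso_std_prod F hFG.of_prod_left hcon.1
  obtain ⟨τ', G', hG⟩ := exists_iso_std_prod G hFG.of_prod_right hcon.2
  have h1 : (std R p σ).Iso ((std R p τ).prod ((std R p τ').prod (F'.prod G'))) :=
    (h.trans (hF.prod hG)).trans ((iso_prod_assoc _ _ _).trans
      ((Iso.refl _).prod (iso_prod_left_comm _ _ _)))
  have h2 : (F'.prod G').InS2 := (h1.InS2 (std_InS2 σ)).of_prod_right.of_prod_right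
  obtain ⟨n, ρ, hρ⟩ := exists_iso_directSum_std _ h2
  let ρ' : Fin (n + 1 + 1) → Shape :=
    Fin.cons (α := fun _ => Shape) τ (Fin.cons (α := fun _ => Shape) τ' ρ)
  have h3 : (std R p σ).Iso (directSum fun i => std R p (ρ' i)) :=
    h1.trans (((Iso.refl _).prod (((Iso.refl _).prod hρ).trans
      (iso_directSum_succ fun i => std R p (ρ' i.succ)))).trans
      (iso_directSum_succ fun i => std R p (ρ' i)))
  obtain ⟨e, -⟩ := exists_equiv_of_card_fiber_eq
    (card_fiber_eq_of_iso (iso_directSum_single (std R p σ)) h3)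
  have := Fintype.card_congr e
  simp only [Fintype.card_fin] at this
  omega

theorem exists_iso_std_of_indecomposable {F : PEmb R p} (hF : F.InS2) (h : F.Indecomposable) :
    ∃ σ, F.Iso (std R p σ) := by
  obtain ⟨σ, F', hF'⟩ := exists_iso_std_prod F hF h.1
  refine ⟨σ, hF'.trans (Iso.symm ?_)⟩
  have h0 : F'.IsZero := (h.2 _ _ hF').resolve_left (not_isZero_std σ)
  have : Subsingleton F'.B := h0
  let e : (std R p σ).B ≃ₗ[R] (std R p σ).B × F'.B :=
    { LinearMap.inl R (std R p σ).B F'.B with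
      invFun := Prod.fst
      left_inv := fun _ => rfl
      right_inv := fun _ => Prod.ext rfl (Subsingleton.elim _ _) }
  refine ⟨e, le_antisymm ?_ ?_⟩
  · rintro _ ⟨x, hx, rfl⟩
    exact ⟨hx, F'.A.zero_mem⟩
  · rintro ⟨x, y⟩ ⟨hx, -⟩
    exact ⟨x, hx, Prod.ext rfl (Subsingleton.elim _ _)⟩

theorem hasMultiplicity_std {E : PEmb R p} (hE : E.InS2) (τ : Shape) :
    HasMultiplicity (std R p τ) E (E.klein.mult τ) := by
  refine ⟨?_, fun n F hF => ?_⟩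
  · obtain ⟨n, σ, hσ⟩ := exists_iso_directSum_std E hE
    exact ⟨n, _, fun i => indecomposable_std (σ i), hσ⟩
  · have hF2 : ∀ i, (F i).InS2 := (hF.2.InS2 hE).of_directSum
    choose σ hσ using fun i => exists_iso_std_of_indecomposable (hF2 i) (hF.1 i)
    have h := hF.2.trans (iso_directSum_congr (G := fun i => std R p (σ i)) (Equiv.refl _) hσ)
    rw [klein_mult hE h, ← Fintype.card_subtype, ← Nat.card_eq_fintype_card]
    refine congrArg Nat.cast (Nat.card_congr (Equiv.subtypeEquivRight fun i => ?_))
    exact ⟨fun hi => eq_of_std_iso ((hσ i).symm.trans hi), fun hi => hi ▸ hσ i⟩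

theorem klein_isKlein_of_InS2 {E : PEmb R p} (hE : E.InS2) :
    E.klein.IsKlein ∧ E.klein.EntriesAtMost 2 := by
  obtain ⟨n, σ, hσ⟩ := exists_iso_directSum_std E hE
  exact ⟨klein_isKlein hE hσ, klein_entriesAtMost hσ⟩

theorem klein_eq_of_iso {E F : PEmb R p} (hE : E.InS2) (h : E.Iso F) : E.klein = F.klein := by
  have hF := h.InS2 hE
  obtain ⟨n, σ, hσ⟩ := exists_iso_directSum_std E hE
  refine (klein_isKlein_of_InS2 hE).1.ext_mult (klein_isKlein_of_InS2 hE).2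
    (klein_isKlein_of_InS2 hF).1 (klein_isKlein_of_InS2 hF).2 (funext fun τ => ?_)
  rw [klein_mult hE hσ, klein_mult hF (h.symm.trans hσ)]

theorem iso_of_klein_eq {E F : PEmb R p} (hE : E.InS2) (hF : F.InS2) (h : E.klein = F.klein) :
    E.Iso F := by
  obtain ⟨n, σ, hσ⟩ := exists_iso_directSum_std E hE
  obtain ⟨n', σ', hσ'⟩ := exists_iso_directSum_std F hF
  obtain ⟨e, he⟩ := exists_equiv_of_card_fiber_eq (σ := σ) (σ' := σ') fun τ => by
    rw [← klein_mult hE hσ, ← klein_mult hF hσ', h]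
  refine hσ.trans ((iso_directSum_congr e fun i => ?_).trans hσ'.symm)
  rw [he]
  exact Iso.refl _

/-- The direct sum with the multiplicities of `T` has a tableau with the same multiplicities, hence
equal to `T`. -/
theorem exists_klein_eq (R : Type u) [CommRing R] [IsDomain R] [IsPrincipalIdealRing R] (p : R)
    [Fact (Prime p)] {T : TableauData} (hT : T.IsKlein) (hT2 : T.EntriesAtMost 2) :
    ∃ E : PEmb R p, E.InS2 ∧ E.klein = T := by
  obtain ⟨n, σ, hσ⟩ := exists_family_of_finite_support (hT.finite_support_mult hT2)
  have hE : (directSum fun i => std R p (σ i)).InS2 := InS2.directSum fun i => std_InS2 (σ i)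
  refine ⟨_, hE, (klein_isKlein_of_InS2 hE).1.ext_mult (klein_isKlein_of_InS2 hE).2 hT hT2
    (funext fun τ => ?_)⟩
  rw [klein_mult hE (Iso.refl _), hσ]

theorem exists_iso_std_iff (F : PEmb R p) : (∃ σ, F.Iso (std R p σ)) ↔
    (∃ l m : ℕ, 1 ≤ m ∧ l ≤ min 2 m ∧ F.Iso (picket R p l m)) ∨
      ∃ m r : ℕ, 1 ≤ r ∧ r + 2 ≤ m ∧ F.Iso (bipicket R p m r) := by
  constructor
  · rintro ⟨t | t | ⟨s, _ | d⟩, h⟩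
    · exact Or.inl ⟨0, t + 1, by omega, by omega, h⟩
    · exact Or.inl ⟨1, t + 1, by omega, by omega, h⟩
    · exact Or.inl ⟨2, s + 2, by omega, by omega, h⟩
    · exact Or.inr ⟨s + d + 3, s + 1, by omega, by omega, h⟩
  · rintro (⟨l, m, hm, hl, h⟩ | ⟨m, r, hr, hm, h⟩)
    · have hl2 : l < 3 := by omega
      interval_cases l
      · obtain ⟨t, rfl⟩ := Nat.exists_eq_add_of_le' hm
        exact ⟨.emb t, h⟩
      · obtain ⟨t, rfl⟩ := Nat.exists_eq_add_of_le' hm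
        exact ⟨.soc t, h⟩
      · obtain ⟨s, rfl⟩ := Nat.exists_eq_add_of_le' (by omega : 2 ≤ m)
        exact ⟨.two s 0, h⟩
    · obtain ⟨s, rfl⟩ := Nat.exists_eq_add_of_le' hr
      obtain ⟨d, rfl⟩ := Nat.exists_eq_add_of_le hm
      refine ⟨.two s (d + 1), ?_⟩
      rwa [show s + 1 + 2 + d = s + d + 3 by omega] at h

/-- The map from isomorphism classes of `𝒮₂` to Klein tableaux with entries at most `2`. -/
noncomputable def kleinClass (R : Type u) [CommRing R] [IsDomain R] [IsPrincipalIdealRing R]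
    (p : R) [Fact (Prime p)] (x : Quotient (isoSetoid R p)) :
    {T : TableauData // T.IsKlein ∧ T.EntriesAtMost 2} :=
  Quotient.lift (fun E : {E : PEmb R p // E.InS2} => ⟨E.1.klein, klein_isKlein_of_InS2 E.2⟩)
    (fun E _ h => Subtype.ext (klein_eq_of_iso E.2 h)) x

theorem kleinClass_bijective : Function.Bijective (kleinClass R p) := by
  constructor
  · intro x y
    refine Quotient.inductionOn₂ x y fun E F h => Quotient.sound ?_
    exact iso_of_klein_eq E.2 F.2 (congrArg Subtype.val h)
  · rintro ⟨T, hT, hT2⟩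
    obtain ⟨E, hE, hET⟩ := exists_klein_eq R p hT hT2
    exact ⟨Quotient.mk _ ⟨E, hE⟩, Subtype.ext hET⟩

end PEmb

theorem mainTheorem4 {R : Type u} [CommRing R] [IsDomain R] [IsPrincipalIdealRing R]
    (p : R) [Fact (Prime p)] :
    -- the map `E ↦ Π(E)` is a well-defined bijection
    (∃ Φ : Quotient (PEmb.isoSetoid R p) ≃
        {T : TableauData // T.IsKlein ∧ T.EntriesAtMost 2},
      ∀ E : {E : PEmb R p // E.InS2},
        (Φ (Quotient.mk (PEmb.isoSetoid R p) E) : TableauData) = E.1.klein) ∧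
    -- the indecomposable objects
    (∀ F : PEmb R p, F.InS2 → (F.Indecomposable ↔
      (∃ l m : ℕ, 1 ≤ m ∧ l ≤ min 2 m ∧ F.Iso (PEmb.picket R p l m)) ∨
      (∃ m r : ℕ, 1 ≤ r ∧ r + 2 ≤ m ∧ F.Iso (PEmb.bipicket R p m r)))) ∧
    -- the multiplicities
    (∀ E : PEmb R p, E.InS2 →
      (∀ m r : ℕ, 1 ≤ r → r + 2 ≤ m →
        PEmb.HasMultiplicity (PEmb.bipicket R p m r) E (E.klein.numSymbolInRow 2 r m)) ∧
      (∀ m : ℕ, 2 ≤ m →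
        PEmb.HasMultiplicity (PEmb.picket R p 2 m) E (E.klein.numSymbolInRow 2 (m - 1) m)) ∧
      (∀ m : ℕ, 1 ≤ m →
        PEmb.HasMultiplicity (PEmb.picket R p 1 m) E
          ((E.klein.numEntry 1 m : ℤ) - E.klein.numSymbol 2 m)) ∧
      (∀ m : ℕ, 1 ≤ m →
        PEmb.HasMultiplicity (PEmb.picket R p 0 m) E
          (E.klein.numEmptyCol m + E.klein.numEmptyAbove m 2 m))) := by
  refine ⟨⟨Equiv.ofBijective _ PEmb.kleinClass_bijective, fun E => rfl⟩, fun F hF => ?_,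
    fun E hE => ⟨fun m r hr hm => ?_, fun m hm => ?_, fun m hm => ?_, fun m hm => ?_⟩⟩
  · rw [← PEmb.exists_iso_std_iff]
    exact ⟨PEmb.exists_iso_std_of_indecomposable hF,
      fun ⟨σ, h⟩ => h.symm.indecomposable (PEmb.indecomposable_std σ)⟩
  · obtain ⟨s, rfl⟩ := Nat.exists_eq_add_of_le' hr
    obtain ⟨d, rfl⟩ := Nat.exists_eq_add_of_le hm
    rw [show s + 1 + 2 + d = s + d + 3 by omega]
    exact PEmb.hasMultiplicity_std hE (.two s (d + 1))
  · obtain ⟨s, rfl⟩ := Nat.exists_eq_add_of_le' hm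
    exact PEmb.hasMultiplicity_std hE (.two s 0)
  · obtain ⟨t, rfl⟩ := Nat.exists_eq_add_of_le' hm
    -- Condition (iv) makes the truncated subtraction in `mult` agree with the integer difference.
    have hle := ((PEmb.klein_isKlein_of_InS2 hE).1.subscript 2 le_rfl).card_le (t + 1)
    have h := PEmb.hasMultiplicity_std hE (.soc t)
    simp only [TableauData.mult] at h
    rwa [Nat.cast_sub hle] at h
  · obtain ⟨t, rfl⟩ := Nat.exists_eq_add_of_le' hm
    have h := PEmb.hasMultiplicity_std hE (.emb t)
    simp only [TableauData.mult] at h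
    rwa [Nat.cast_add] at h
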